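/- Let $0<\alpha<2$, $\delta\in\mathbb R$, $K\in\mathbb N$, $\gamma_1,\dots,\gamma_K>0$, and let $S_1,\dots,S_K$ be independent real random variables with $S_k\sim\mathrm{Stable}(\alpha,1,\gamma_k,\delta)$ in the 1-parameterization, i.e. $$\mathbb E e^{iuS_k}=\exp\bigl[-\gamma_k^\alpha|u|^\alpha\{1-i\,\omega(u)\,\mathrm{sign}(u)\}+i\delta u\bigr],\qquad u\in\mathbb R,$$ with $\omega(u)=\tan(\pi\alpha/2)$ if $\alpha\neq1$ and $\omega(u)=-\tfrac2\pi\log|u|$ if $\alpha=1$. Let $w_1,\dots,w_K\ge0$ be kernel functions on a set $\mathcal S$ of locations such that at every $s\in\mathcal S$ at least one $w_k(s)$ is non-zero (for instance $\sum_k w_k(s)=1$), and let $R(s)=\sum_{k=1}^K w_k(s)S_k$. For two locations $s_i,s_j\in\mathcal S$ write $w_{ki}=w_k(s_i)$, $R_i=R(s_i)$, $\mathcal C_i=\{k:w_{ki}\ne0\}$, $\bar\gamma_i=\{\sum_{k=1}^K(w_{ki}\gamma_k)^\alpha\}^{1/\alpha}$, and likewise for $j$; let $C_\alpha=\Gamma(\alpha)\sin(\alpha\pi/2)/\pi$.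 All asymptotic equivalences are for $x\to\infty$. (a) If $\mathcal C_i\cap\mathcal C_j=\emptyset$, then $R_i$ and $R_j$ are independent and $$\Pr(R_i>x,R_j>x)\sim4C_\alpha^2\,\bar\gamma_i^\alpha\,\bar\gamma_j^\alpha\,x^{-2\alpha}.$$ If $\mathcal C_i\cap\mathcal C_j\neq\emptyset$, then $$\Pr(R_i>x,R_j>x)\sim2C_\alpha\sum_{k=1}^K\min(w_{ki},w_{kj})^\alpha\gamma_k^\alpha\,x^{-\alpha}.$$ (b) If $\mathcal C_i\cap\mathcal C_j\neq\emptyset$, then for all constants $0<\phi_i<\phi_j$ and $c_i,c_j>0$ there are constants $d_\wedge,d_\vee$ with $$\Pr\{\min(c_iR_i^{\phi_i},c_jR_j^{\phi_j})>x\}\sim d_\wedge x^{-\alpha/\phi_i},\qquad \Pr\{\max(c_iR_i^{\phi_i},c_jR_j^{\phi_j})>x\}\sim d_\vee x^{-\alpha/\phi_j}$$ and $$2C_\alpha\sum_{k\in\mathcal C_i\cap\mathcal C_j}(w_{ki}\gamma_k)^\alpha c_i^{\alpha/\phi_i}\le d_\wedge\le2^{\alpha+1}C_\alpha\sum_{k\in\mathcal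 C_i}(w_{ki}\gamma_k)^\alpha c_i^{\alpha/\phi_i},$$ $$2C_\alpha\sum_{k\in\mathcal C_i\cap\mathcal C_j}(w_{kj}\gamma_k)^\alpha c_j^{\alpha/\phi_j}\le d_\vee\le2^{\alpha+1}C_\alpha\sum_{k\in\mathcal C_j}(w_{kj}\gamma_k)^\alpha c_j^{\alpha/\phi_j}.$$ Here $R_i,R_j\ge0$ almost surely when $\alpha<1$ and $\delta\ge0$; in the other cases the power of a negative number $r$ is read as $r^{\phi}=|r|^{\phi}\cos(\pi\phi)$. -/

import Mathlib

open MeasureTheory ProbabilityTheory Filter Asymptotics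

noncomputable section

namespace StableMixture

/-- The factor `ω(u)` in the characteristic function of a stable law (1-parameterization). -/
def omega (α u : ℝ) : ℝ :=
  if α = 1 then -(2 / Real.pi) * Real.log |u| else Real.tan (Real.pi * α / 2)

/-- The characteristic function of `Stable(α, β, γ, δ)` in the 1-parameterization,
`exp(-γ^α |u|^α {1 - i β ω(u) sign(u)} + i δ u)`. -/
def stableCharFun (α β γ δ u : ℝ) : ℂ :=
  Complex.exp
    (-((γ ^ α * |u| ^ α : ℝ) : ℂ) * (1 - Complex.I * ((β * omega α u * Real.sign u : ℝ) : ℂ))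
      + Complex.I * ((δ * u : ℝ) : ℂ))

/-- The random variable `X` has the law `Stable(α, β, γ, δ)` (1-parameterization) under `μ`. -/
def IsStable {Ω : Type*} [MeasurableSpace Ω] (μ : Measure Ω) (X : Ω → ℝ) (α β γ δ : ℝ) : Prop :=
  ∀ u : ℝ, charFun (μ.map X) u = stableCharFun α β γ δ u

/-- `C_α = Γ(α) sin(απ/2) / π`. -/
def tailConst (α : ℝ) : ℝ :=
  Real.Gamma α * Real.sin (α * Real.pi / 2) / Real.pi

variable {K : ℕ} {𝒮 : Type*}

/-- The mixture `R(s) = ∑ k, w_k(s) S_k` at the location `s`. -/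
def mixture {Ω : Type*} (w : Fin K → 𝒮 → ℝ) (S : Fin K → Ω → ℝ) (s : 𝒮) (ω : Ω) : ℝ :=
  ∑ k, w k s * S k ω

/-- The set of indices of the kernels that do not vanish at `s`. -/
def active (w : Fin K → 𝒮 → ℝ) (s : 𝒮) : Finset (Fin K) :=
  Finset.univ.filter fun k => w k s ≠ 0

/-- `γ̄(s) = (∑ k, (w_k(s) γ_k)^α)^(1/α)`. -/
def gammaBar (α : ℝ) (w : Fin K → 𝒮 → ℝ) (γ : Fin K → ℝ) (s : 𝒮) : ℝ :=
  (∑ k, (w k s * γ k) ^ α) ^ (1 / α)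

/-- `∑ k, min(w_k(s), w_k(t))^α γ_k^α`. -/
def sharedConst (α : ℝ) (w : Fin K → 𝒮 → ℝ) (γ : Fin K → ℝ) (s t : 𝒮) : ℝ :=
  ∑ k, min (w k s) (w k t) ^ α * γ k ^ α

end StableMixture

end

/-! Everything rests on two facts about a totally skewed stable variable: `x ^ α * P(S_k > x)` tends
to `2 C_α γ_k ^ α`, and the left tail is `o(x ^ (-α))`. Given these, a finite weighted sum of
independent `S_k` is large essentially because exactly one summand is large, so each joint event
splits asymptotically into disjoint events, each about a single `S_k`.

The two tails are read off the characteristic function. The law of `S / x`, multiplied by `x ^ α`,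
should converge away from `0` to the Lévy measure `2 C_α α γ ^ α y ^ (-α - 1) dy` on `(0, ∞)`, which
has infinite mass near `0`. The weight `1 - cos y` makes all measures finite and turns
characteristic functions into second differences, in which the linear drift terms of the exponent
cancel, including the logarithmic one at `α = 1`. The limit is identified by
`integral_one_sub_cos_mul_cexp_eq_stableExponent`, a Laplace transform computed in the right half
plane and carried to the imaginary axis. The continuity theorem then gives the mass of `(x, 2x]`,
and `tendsto_rpow_mul_measureReal_Ioi` sums the dyadic blocks.

The single-jump argument is `tendsto_rpow_mul_of_big_jump`. At a common level `x`, a jump of `S_k`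
lifts both mixtures when `min(w_ki, w_kj) S_k > x`. For powers, the levels become thresholds of
orders `x ^ (1/φ_i)` and `x ^ (1/φ_j)`, the second being negligible against the first. For the
minimum, a jump lifting `R_i` over its threshold also lifts `R_j` as soon as `w_kj ≠ 0`; for the
maximum, only `R_j` matters. Hence `d_∧` and `d_∨` are explicit: `2 C_α` times the sum over `C_i ∩
C_j`, respectively over `C_j`, times the power of `c_i` or `c_j`. -/

noncomputable section

namespace StableMixture

open Set Topology

/-! ### Laplace transforms of the jump kernel -/

/-- The Laplace transform of a power on the right half plane. -/
lemma integral_rpow_mul_cexp_neg_mul_Ioi {a : ℝ} (ha : 0 < a) {z : ℂ} (hz : 0 < z.re) :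
    ∫ y in Ioi (0 : ℝ), ((y ^ (a - 1) : ℝ) : ℂ) * Complex.exp (-(z * y))
      = Real.Gamma a * z ^ (-(a : ℂ)) := by
  set ρ : Measure ℝ := (volume.restrict (Ioi 0)).withDensity
    fun y => ENNReal.ofReal (y ^ (a - 1)) with hρ
  have hcm : ∀ z : ℂ, complexMGF id ρ (-z)
      = ∫ y in Ioi (0 : ℝ), ((y ^ (a - 1) : ℝ) : ℂ) * Complex.exp (-(z * y)) := by
    intro z
    rw [complexMGF, hρ, integral_withDensity_eq_integral_toReal_smul (by fun_prop)
      (by simp)]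
    refine setIntegral_congr_fun measurableSet_Ioi fun y hy => ?_
    have : 0 ≤ y ^ (a - 1) := Real.rpow_nonneg (le_of_lt hy) _
    simp [ENNReal.toReal_ofReal this]
  have hexp : Iio 0 ⊆ integrableExpSet id ρ := by
    intro t ht
    simp only [integrableExpSet, mem_ofPred_eq, id, hρ]
    rw [integrable_withDensity_iff_integrable_smul' (by fun_prop) (by simp)]
    have h := integrableOn_rpow_mul_exp_neg_mul_rpow (p := 1) (s := a - 1) (b := -t)
      (by linarith) (by norm_num) (by simpa using ht)
    refine h.congr_fun (fun y hy => ?_) measurableSet_Ioi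
    have : 0 ≤ y ^ (a - 1) := Real.rpow_nonneg (le_of_lt hy) _
    simp [ENNReal.toReal_ofReal this]
  have hint : Iio 0 ⊆ interior (integrableExpSet id ρ) :=
    interior_maximal hexp isOpen_Iio
  let U : Set ℂ := {z | 0 < z.re}
  have hU : IsOpen U := isOpen_lt continuous_const Complex.continuous_re
  -- Both sides are analytic on the half plane, so by the identity theorem it is enough that they
  -- agree at real points accumulating at `1`.
  have h1 : AnalyticOnNhd ℂ (fun z => complexMGF id ρ (-z)) U := by
    refine DifferentiableOn.analyticOnNhd (fun z hz => ?_) hU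
    have : DifferentiableAt ℂ (complexMGF id ρ) (-z) :=
      (analyticAt_complexMGF (hint (by simpa [U] using hz))).differentiableAt
    exact (this.comp z differentiable_neg.differentiableAt).differentiableWithinAt
  have h2 : AnalyticOnNhd ℂ (fun z => (Real.Gamma a : ℂ) * z ^ (-(a : ℂ))) U := by
    refine DifferentiableOn.analyticOnNhd (fun z hz => ?_) hU
    have : z ∈ Complex.slitPlane := Or.inl hz
    refine DifferentiableAt.differentiableWithinAt ?_
    fun_prop (disch := assumption)
  have hreal : ∀ x : ℝ, 0 < x → complexMGF id ρ (-(x : ℂ))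
      = (Real.Gamma a : ℂ) * (x : ℂ) ^ (-(a : ℂ)) := by
    intro x hx
    rw [hcm]
    have h := Real.integral_rpow_mul_exp_neg_mul_Ioi ha hx
    have h' : ∫ y in Ioi (0 : ℝ), ((y ^ (a - 1) : ℝ) : ℂ) * Complex.exp (-((x : ℂ) * y))
        = ∫ y in Ioi (0 : ℝ), ((y ^ (a - 1) * Real.exp (-(x * y)) : ℝ) : ℂ) := by
      congr 1; ext y; push_cast; rfl
    rw [h', integral_complex_ofReal, h, one_div, Real.inv_rpow hx.le, ← Real.rpow_neg hx.le]
    push_cast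
    rw [Complex.ofReal_cpow hx.le]
    push_cast
    ring
  have hconn : IsPreconnected U := (convex_halfSpace_re_gt 0).isPreconnected
  have hfreq : ∃ᶠ w in 𝓝[≠] (1 : ℂ), complexMGF id ρ (-w)
      = (Real.Gamma a : ℂ) * w ^ (-(a : ℂ)) := by
    have ht : Tendsto (fun n : ℕ => ((1 + 1 / ((n : ℝ) + 1) : ℝ) : ℂ)) atTop (𝓝[≠] 1) := by
      refine tendsto_nhdsWithin_iff.2 ⟨?_, Eventually.of_forall fun n => ?_⟩
      · have h : Tendsto (fun n : ℕ => 1 + 1 / ((n : ℝ) + 1)) atTop (𝓝 (1 + 0)) :=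
          tendsto_const_nhds.add tendsto_one_div_add_atTop_nhds_zero_nat
        have := (Complex.continuous_ofReal.tendsto _).comp h
        simpa [Function.comp_def] using this
      · simp only [mem_compl_iff, mem_singleton_iff]
        have : (0 : ℝ) < 1 / ((n : ℝ) + 1) := by positivity
        exact_mod_cast (by simpa using this.ne' : (1 : ℝ) + 1 / ((n : ℝ) + 1) ≠ 1)
    refine ht.frequently (Frequently.of_forall fun n => hreal _ (by positivity))
  have := h1.eqOn_of_preconnected_of_frequently_eq h2 hconn (z₀ := 1) (by simp [U]) hfreq hz
  rw [← hcm]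
  exact this

/-- The jump kernel `(1 - cos (s y)) y ^ (-α - 1)` of a stable law is integrable. -/
lemma integrableOn_one_sub_cos_mul_rpow {α : ℝ} (hα0 : 0 < α) (hα2 : α < 2) (s : ℝ) :
    IntegrableOn (fun y : ℝ => y ^ (-α - 1) * (1 - Real.cos (s * y))) (Ioi 0) := by
  rw [← Ioc_union_Ioi_eq_Ioi (zero_le_one' ℝ)]
  refine IntegrableOn.union ?_ ?_
  -- Near `0` the quadratic bound on `1 - cos` leaves `y ^ (1 - α)`, integrable as `α < 2`; at
  -- infinity the bound `2` suffices as `α > 0`.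
  · have h : IntegrableOn (fun y : ℝ => s ^ 2 / 2 * y ^ (1 - α)) (Ioc 0 1) := by
      refine Integrable.const_mul ?_ _
      exact (intervalIntegrable_iff_integrableOn_Ioc_of_le zero_le_one).1
        (intervalIntegral.intervalIntegrable_rpow' (by linarith))
    refine Integrable.mono' h (by fun_prop) ?_
    refine (ae_restrict_iff' measurableSet_Ioc).2 (Eventually.of_forall fun y hy => ?_)
    have h0 : 0 ≤ y ^ (-α - 1) := Real.rpow_nonneg hy.1.le _
    have h1 : 0 ≤ 1 - Real.cos (s * y) := by linarith [Real.cos_le_one (s * y)]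
    have h2 := Real.one_sub_sq_div_two_le_cos (x := s * y)
    rw [Real.norm_of_nonneg (mul_nonneg h0 h1)]
    have h3 : y ^ (1 - α) = y ^ (-α - 1) * y ^ 2 := by
      rw [← Real.rpow_natCast, ← Real.rpow_add hy.1]
      congr 1; push_cast; ring
    rw [h3]
    nlinarith
  · have h : IntegrableOn (fun y : ℝ => y ^ (-α - 1) * 2) (Ioi 1) :=
      (integrableOn_Ioi_rpow_of_lt (by linarith) one_pos).mul_const _
    refine Integrable.mono' h (by fun_prop) ?_
    refine (ae_restrict_iff' measurableSet_Ioi).2 (Eventually.of_forall fun y hy => ?_)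
    have hy0 : 0 < y := lt_trans one_pos hy
    have h0 : 0 ≤ y ^ (-α - 1) := Real.rpow_nonneg hy0.le _
    have h1 : 0 ≤ 1 - Real.cos (s * y) := by linarith [Real.cos_le_one (s * y)]
    rw [Real.norm_of_nonneg (mul_nonneg h0 h1)]
    have := Real.neg_one_le_cos (s * y)
    gcongr
    linarith

/-- Taylor's formula with integral remainder. The factor `y ^ 2` turns the singular kernel `y ^ (-α
- 1)` into `y ^ (1 - α)`, whose Laplace transform exists. -/
lemma one_sub_cos_eq_integral (s y : ℝ) :
    1 - Real.cos (s * y) = ∫ r in (0 : ℝ)..s, (s - r) * (y ^ 2 * Real.cos (r * y)) := by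
  have hd : ∀ r ∈ uIcc 0 s, HasDerivAt
      (fun r => (s - r) * (y * Real.sin (r * y)) - Real.cos (r * y))
      ((s - r) * (y ^ 2 * Real.cos (r * y))) r := by
    intro r _
    have h1 : HasDerivAt (fun r : ℝ => r * y) y r := by simpa using (hasDerivAt_id r).mul_const y
    have h2 := (Real.hasDerivAt_sin (r * y)).comp r h1
    have h3 := (Real.hasDerivAt_cos (r * y)).comp r h1
    have h4 : HasDerivAt (fun r : ℝ => s - r) (-1) r := by
      simpa using (hasDerivAt_id r).const_sub s
    convert! (h4.mul (h2.const_mul y)).sub h3 using 1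
    simp only [Function.comp]
    ring
  rw [intervalIntegral.integral_eq_sub_of_hasDerivAt hd
    (Continuous.intervalIntegrable (by fun_prop) _ _)]
  simp only [sub_self, zero_mul, Real.sin_zero, Real.cos_zero, mul_zero]
  ring

/-- After Fubini the inner integral is a Laplace transform proportional to `z ^ (α - 2)`, and
integrating against `s - r` yields a second difference of any second antiderivative `P`. Leaving `P`
abstract covers the power case `α ≠ 1` and the logarithmic case `α = 1` together. -/
lemma integral_one_sub_cos_mul_cexp_of_re_pos {α : ℝ} (hα2 : α < 2) {s : ℝ} (hs : 0 ≤ s)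
    {P P' : ℂ → ℂ} (hP : ∀ z : ℂ, 0 < z.re → HasDerivAt P (P' z) z)
    (hP' : ∀ z : ℂ, 0 < z.re → HasDerivAt P' (z ^ ((α : ℂ) - 2)) z) {z : ℂ} (hz : 0 < z.re) :
    ∫ y in Ioi (0 : ℝ), ((y ^ (-α - 1) * (1 - Real.cos (s * y)) : ℝ) : ℂ) * Complex.exp (-(z * y))
      = Real.Gamma (2 - α) * (P z - (P (z + s * Complex.I) + P (z - s * Complex.I)) / 2) := by
  set f : ℝ → ℝ → ℂ := fun y r =>
    (((y ^ (1 - α) : ℝ) : ℂ) * Complex.exp (-(z * y))) * (((s - r) * Real.cos (r * y) : ℝ) : ℂ)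
    with hf
  have h1 : ∀ y ∈ Ioi (0 : ℝ),
      ((y ^ (-α - 1) * (1 - Real.cos (s * y)) : ℝ) : ℂ) * Complex.exp (-(z * y))
        = ∫ r in Ioc 0 s, f y r := by
    intro y hy
    have hy' : y ^ (1 - α) = y ^ (-α - 1) * y ^ 2 := by
      rw [← Real.rpow_natCast, ← Real.rpow_add hy]
      congr 1; push_cast; ring
    rw [one_sub_cos_eq_integral, intervalIntegral.integral_of_le hs, hf]
    dsimp only
    rw [integral_const_mul, integral_complex_ofReal, ← integral_const_mul,
      ← integral_complex_ofReal, ← integral_complex_ofReal, ← integral_mul_const,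
      ← integral_const_mul]
    congr 1
    ext r
    rw [hy']
    push_cast
    ring
  have hexp : ∀ w : ℂ, 0 < w.re → IntegrableOn
      (fun y : ℝ => ((y ^ (1 - α) : ℝ) : ℂ) * Complex.exp (-(w * y))) (Ioi 0) := by
    intro w hw
    have h := integrableOn_rpow_mul_exp_neg_mul_rpow (p := 1) (s := 1 - α) (b := w.re)
      (by linarith) (by norm_num) hw
    refine Integrable.mono' h (by fun_prop) ?_
    refine (ae_restrict_iff' measurableSet_Ioi).2 (Eventually.of_forall fun y hy => ?_)
    have h0 : 0 ≤ y ^ (1 - α) := Real.rpow_nonneg (le_of_lt hy) _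
    rw [norm_mul, Complex.norm_exp, Complex.norm_real, Real.norm_of_nonneg h0]
    simp
  have hint : Integrable (Function.uncurry f)
      ((volume.restrict (Ioi 0)).prod (volume.restrict (Ioc 0 s))) := by
    have hs' : IntegrableOn (fun _ : ℝ => s) (Ioc 0 s) := by
      simp [integrableOn_const_iff]
    refine Integrable.mono' ((hexp z hz).norm.mul_prod hs') ?_ ?_
    · refine Measurable.aestronglyMeasurable ?_
      simp only [hf, Function.uncurry_def]
      fun_prop
    · rw [Measure.prod_restrict]
      refine (ae_restrict_iff' (measurableSet_Ioi.prod measurableSet_Ioc)).2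
        (Eventually.of_forall fun p hp => ?_)
      simp only [hf, Function.uncurry_def]
      rw [norm_mul]
      refine mul_le_mul_of_nonneg_left ?_ (norm_nonneg _)
      have h2 := (mem_prod.1 hp).2
      rw [Complex.norm_real, norm_mul]
      have h3 : ‖s - p.2‖ ≤ s := by
        rw [Real.norm_of_nonneg (by linarith [h2.2])]; linarith [h2.1]
      calc ‖s - p.2‖ * ‖Real.cos (p.2 * p.1)‖ ≤ s * 1 :=
            mul_le_mul h3 (Real.abs_cos_le_one _) (norm_nonneg _) hs
        _ = s := mul_one s
  have hre : ∀ r : ℝ, 0 < (z + r * Complex.I).re ∧ 0 < (z - r * Complex.I).re := by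
    intro r; simp [hz]
  have h2 : ∀ r : ℝ, ∫ y in Ioi (0 : ℝ), f y r
      = Real.Gamma (2 - α) * ((s - r : ℝ) *
        (((z + r * Complex.I) ^ ((α : ℂ) - 2) + (z - r * Complex.I) ^ ((α : ℂ) - 2)) / 2)) := by
    intro r
    have e : ∀ y : ℝ, f y r = ((s - r : ℝ) : ℂ) / 2 *
        (((y ^ (1 - α) : ℝ) : ℂ) * Complex.exp (-((z + r * Complex.I) * y))
        + ((y ^ (1 - α) : ℝ) : ℂ) * Complex.exp (-((z - r * Complex.I) * y))) := by
      intro y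
      have hc : ((Real.cos (r * y) : ℝ) : ℂ)
          = (Complex.exp (r * y * Complex.I) + Complex.exp (-(r * y) * Complex.I)) / 2 := by
        rw [Complex.ofReal_cos, Complex.cos]; push_cast; rfl
      have e1 : Complex.exp (-((z + r * Complex.I) * y))
          = Complex.exp (-(z * y)) * Complex.exp (-(r * y) * Complex.I) := by
        rw [← Complex.exp_add]; congr 1; ring
      have e2 : Complex.exp (-((z - r * Complex.I) * y))
          = Complex.exp (-(z * y)) * Complex.exp (r * y * Complex.I) := by
        rw [← Complex.exp_add]; congr 1; ring
      simp only [hf]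
      rw [Complex.ofReal_mul, hc, e1, e2]
      ring
    simp_rw [e]
    have hΓ : ∀ w : ℂ, 0 < w.re → ∫ y in Ioi (0 : ℝ),
        ((y ^ (1 - α) : ℝ) : ℂ) * Complex.exp (-(w * y))
        = Real.Gamma (2 - α) * w ^ ((α : ℂ) - 2) := by
      intro w hw
      have := integral_rpow_mul_cexp_neg_mul_Ioi (a := 2 - α) (by linarith) hw
      rw [show 2 - α - 1 = 1 - α by ring] at this
      rw [this]; congr 2; push_cast; ring
    rw [integral_const_mul, integral_add (hexp _ (hre r).1) (hexp _ (hre r).2),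
      hΓ _ (hre r).1, hΓ _ (hre r).2]
    ring
  -- An explicit primitive in `r`, as produced by integrating by parts twice.
  have hd : ∀ r ∈ uIcc 0 s, HasDerivAt
      (fun r : ℝ => ((s - r : ℝ) : ℂ) *
          ((P' (z + r * Complex.I) - P' (z - r * Complex.I)) / (2 * Complex.I))
        - (P (z + r * Complex.I) + P (z - r * Complex.I)) / 2)
      ((s - r : ℝ) *
        (((z + r * Complex.I) ^ ((α : ℂ) - 2) + (z - r * Complex.I) ^ ((α : ℂ) - 2)) / 2)) r := by
    intro r _
    have a0 : HasDerivAt (fun r : ℝ => (r : ℂ) * Complex.I) Complex.I r := by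
      simpa using (Complex.ofRealCLM.hasDerivAt (x := r)).mul_const Complex.I
    have a1 : HasDerivAt (fun r : ℝ => z + r * Complex.I) Complex.I r := a0.const_add z
    have a2 : HasDerivAt (fun r : ℝ => z - r * Complex.I) (-Complex.I) r := a0.const_sub z
    have a3 : HasDerivAt (fun r : ℝ => ((s - r : ℝ) : ℂ)) (-1) r := by
      simpa using (Complex.ofRealCLM.hasDerivAt (x := r)).const_sub (s : ℂ)
    have b1 := (hP _ (hre r).1).comp r a1
    have b2 := (hP _ (hre r).2).comp r a2
    have c1 := (hP' _ (hre r).1).comp r a1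
    have c2 := (hP' _ (hre r).2).comp r a2
    convert! (a3.mul ((c1.sub c2).div_const (2 * Complex.I))).sub ((b1.add b2).div_const 2) using 1
    simp only [Function.comp, Pi.sub_apply]
    field_simp
    ring_nf
    simp only [Complex.I_sq]
    ring
  rw [setIntegral_congr_fun measurableSet_Ioi h1, integral_integral_swap hint]
  simp_rw [h2]
  rw [integral_const_mul, ← intervalIntegral.integral_of_le hs,
    intervalIntegral.integral_eq_sub_of_hasDerivAt hd]
  · simp only [sub_self, Complex.ofReal_zero, zero_mul, add_zero, sub_zero]
    ring
  · refine Continuous.intervalIntegrable ?_ _ _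
    have k1 : ∀ r : ℝ, z + r * Complex.I ∈ Complex.slitPlane := fun r => Or.inl (hre r).1
    have k2 : ∀ r : ℝ, z - r * Complex.I ∈ Complex.slitPlane := fun r => Or.inl (hre r).2
    refine Continuous.mul (by fun_prop) (Continuous.div_const (Continuous.add ?_ ?_) _)
    · exact Continuous.cpow (by fun_prop) continuous_const k1
    · exact Continuous.cpow (by fun_prop) continuous_const k2

/-- The limit on the imaginary axis of `integral_one_sub_cos_mul_cexp_of_re_pos`. -/
lemma integral_one_sub_cos_mul_cexp {α : ℝ} (hα0 : 0 < α) (hα2 : α < 2) {s : ℝ} (hs : 0 ≤ s)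
    {P P' : ℂ → ℂ} (hP : ∀ z : ℂ, 0 < z.re → HasDerivAt P (P' z) z)
    (hP' : ∀ z : ℂ, 0 < z.re → HasDerivAt P' (z ^ ((α : ℂ) - 2)) z)
    (hPc : ∀ z : ℂ, 0 ≤ z.re → ContinuousAt P z) (u : ℝ) :
    ∫ y in Ioi (0 : ℝ), ((y ^ (-α - 1) * (1 - Real.cos (s * y)) : ℝ) : ℂ) *
        Complex.exp (u * y * Complex.I)
      = Real.Gamma (2 - α) * (P (-(u : ℂ) * Complex.I) -
        (P (-((u + s : ℝ) : ℂ) * Complex.I) + P (-((u - s : ℝ) : ℂ) * Complex.I)) / 2) := by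
  have hl : Tendsto (fun ε : ℝ => ∫ y in Ioi (0 : ℝ),
      ((y ^ (-α - 1) * (1 - Real.cos (s * y)) : ℝ) : ℂ) *
        Complex.exp (-((-(u : ℂ) * Complex.I + ε) * y))) (𝓝[>] 0)
      (𝓝 (∫ y in Ioi (0 : ℝ), ((y ^ (-α - 1) * (1 - Real.cos (s * y)) : ℝ) : ℂ) *
        Complex.exp (u * y * Complex.I))) := by
    -- The exponential has modulus at most `1` for `ε > 0`, so the jump kernel itself dominates.
    refine tendsto_integral_filter_of_dominated_convergence
      (fun y => y ^ (-α - 1) * (1 - Real.cos (s * y)))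
      (Eventually.of_forall fun ε => by fun_prop) ?_
      (integrableOn_one_sub_cos_mul_rpow hα0 hα2 s) ?_
    · filter_upwards [self_mem_nhdsWithin] with ε hε
      refine (ae_restrict_iff' measurableSet_Ioi).2 (Eventually.of_forall fun y hy => ?_)
      have h0 : 0 ≤ y ^ (-α - 1) * (1 - Real.cos (s * y)) :=
        mul_nonneg (Real.rpow_nonneg (le_of_lt hy) _) (by linarith [Real.cos_le_one (s * y)])
      rw [norm_mul, Complex.norm_real, Real.norm_of_nonneg h0, Complex.norm_exp]
      refine mul_le_of_le_one_right h0 (Real.exp_le_one_iff.2 ?_)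
      have : 0 ≤ ε * y := mul_nonneg (le_of_lt hε) (le_of_lt hy)
      simpa using this
    · refine Eventually.of_forall fun y => ?_
      refine Tendsto.mono_left ?_ nhdsWithin_le_nhds
      have : Continuous fun ε : ℝ => ((y ^ (-α - 1) * (1 - Real.cos (s * y)) : ℝ) : ℂ) *
        Complex.exp (-((-(u : ℂ) * Complex.I + ε) * y)) := by fun_prop
      convert this.tendsto 0 using 4
      push_cast; ring
  have hPt : ∀ v : ℝ, Tendsto (fun ε : ℝ => P (-(v : ℂ) * Complex.I + ε)) (𝓝[>] 0)
      (𝓝 (P (-(v : ℂ) * Complex.I))) := by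
    intro v
    refine (hPc _ (by simp)).tendsto.comp ?_
    refine Tendsto.mono_left ?_ nhdsWithin_le_nhds
    have : Continuous fun ε : ℝ => -(v : ℂ) * Complex.I + ε := by fun_prop
    convert this.tendsto 0 using 2
    simp
  refine tendsto_nhds_unique hl ?_
  refine Tendsto.congr' ?_ (Tendsto.const_mul _
    ((hPt u).sub (((hPt (u + s)).add (hPt (u - s))).div_const 2)))
  filter_upwards [self_mem_nhdsWithin] with ε hε
  rw [integral_one_sub_cos_mul_cexp_of_re_pos hα2 hs hP hP' (by simpa using hε), add_comm (P _)]
  congr 5 <;> · push_cast; ring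

/-! ### The stable exponent on the imaginary axis -/

/-- The stable exponent, so that `E exp (i u S) = exp (-γ ^ α ψ(u) + i δ u)`. -/
def stableExponent (α u : ℝ) : ℂ :=
  ((|u| ^ α : ℝ) : ℂ) * (1 - Complex.I * ((omega α u * Real.sign u : ℝ) : ℂ))

/-- Supplies the boundary continuity of the second antiderivative for `α = 1`. The delicate point is
`0`, where the bounded argument leaves only the real limit of `r log r`. -/
lemma continuousAt_mul_log {z : ℂ} (hz : 0 ≤ z.re) :
    ContinuousAt (fun z : ℂ => z * Complex.log z) z := by
  rcases eq_or_ne z 0 with rfl | h0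
  · rw [ContinuousAt, zero_mul]
    refine squeeze_zero_norm (a := fun z : ℂ => |‖z‖ * Real.log ‖z‖| + ‖z‖ * Real.pi) ?_ ?_
    · intro z
      rw [norm_mul, abs_mul, abs_norm, ← mul_add]
      refine mul_le_mul_of_nonneg_left ?_ (norm_nonneg _)
      refine (Complex.norm_le_abs_re_add_abs_im _).trans ?_
      rw [Complex.log_re, Complex.log_im]
      gcongr
      exact Complex.abs_arg_le_pi z
    · have : Continuous fun z : ℂ => |‖z‖ * Real.log ‖z‖| + ‖z‖ * Real.pi :=
        ((Real.continuous_mul_log.comp continuous_norm).abs).add (by fun_prop)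
      simpa using this.tendsto 0
  · have hs : z ∈ Complex.slitPlane := by
      rcases hz.lt_or_eq with h | h
      · exact Or.inl h
      · exact Or.inr fun h' => h0 (Complex.ext h.symm h')
    exact continuousAt_id.mul (continuousAt_clog hs)

lemma log_neg_mul_I {u : ℝ} (hu : u ≠ 0) :
    Complex.log (-(u : ℂ) * Complex.I)
      = (Real.log |u| : ℂ) - ((Real.pi / 2 * Real.sign u : ℝ) : ℂ) * Complex.I := by
  refine Complex.ext ?_ ?_
  · simp [Complex.log_re]
  · rw [Complex.log_im]
    rcases hu.lt_or_gt with h | h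
    · have : -(u : ℂ) * Complex.I = ((-u : ℝ) : ℂ) * Complex.I := by push_cast; ring
      rw [this, Complex.arg_real_mul _ (by linarith), Complex.arg_I, Real.sign_of_neg h]
      simp
    · have : -(u : ℂ) * Complex.I = (u : ℂ) * (-Complex.I) := by ring
      rw [this, Complex.arg_real_mul _ h, Complex.arg_neg_I, Real.sign_of_pos h]
      simp

/-- The argument of `-iu` is `-sign(u) π / 2`, so the principal power has phase `-sign(u) πα / 2`;
dividing by the cosine, nonzero since `α ≠ 1`, leaves the tangent of the skewness term. -/
lemma cpow_neg_mul_I {α : ℝ} (hα0 : 0 < α) (hα2 : α < 2) (hα1 : α ≠ 1) (u : ℝ) :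
    (-(u : ℂ) * Complex.I) ^ (α : ℂ)
      = Real.cos (Real.pi * α / 2) * stableExponent α u := by
  have hcos : Real.cos (Real.pi * α / 2) ≠ 0 := by
    rw [Real.cos_ne_zero_iff]
    intro k hk
    have h : α = 2 * k + 1 := by
      have := Real.pi_pos.ne'
      field_simp at hk
      linarith
    have h1 : (-1 : ℤ) < k := by
      have : (-1 : ℝ) < k := by linarith
      exact_mod_cast this
    have h2 : k < (1 : ℤ) := by
      have : (k : ℝ) < 1 := by linarith
      exact_mod_cast this
    have : k = 0 := by omega
    subst this
    simp at h
    exact hα1 h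
  rcases eq_or_ne u 0 with rfl | hu
  · have : (α : ℂ) ≠ 0 := by exact_mod_cast hα0.ne'
    simp [stableExponent, this, hα0.ne']
  · have hne : -(u : ℂ) * Complex.I ≠ 0 := by simp [hu]
    have hpos : 0 < |u| := abs_pos.2 hu
    rw [Complex.cpow_def_of_ne_zero hne, log_neg_mul_I hu, stableExponent, omega, if_neg hα1,
      Real.tan_eq_sin_div_cos, Real.rpow_def_of_pos hpos]
    have e : (((Real.log |u| : ℝ) : ℂ) - ((Real.pi / 2 * Real.sign u : ℝ) : ℂ) * Complex.I) * α
        = ((Real.log |u| * α : ℝ) : ℂ)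
          + ((-(Real.pi * α / 2 * Real.sign u) : ℝ) : ℂ) * Complex.I := by
      push_cast; ring
    rw [e, Complex.exp_add, Complex.exp_mul_I, ← Complex.ofReal_cos, ← Complex.ofReal_sin,
      ← Complex.ofReal_exp, Real.cos_neg, Real.sin_neg]
    have hc : (Real.cos (Real.pi * α / 2) : ℂ) ≠ 0 := by exact_mod_cast hcos
    rcases hu.lt_or_gt with h | h
    · rw [Real.sign_of_neg h]
      simp only [mul_neg, mul_one, Real.cos_neg, Real.sin_neg]
      generalize Real.cos (Real.pi * α / 2) = c at hc ⊢
      generalize Real.sin (Real.pi * α / 2) = d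
      push_cast
      field_simp
      ring
    · rw [Real.sign_of_pos h]
      simp only [mul_one]
      generalize Real.cos (Real.pi * α / 2) = c at hc ⊢
      generalize Real.sin (Real.pi * α / 2) = d
      push_cast
      field_simp
      ring

/-- The Lévy–Khintchine representation of the second differences of the stable exponent. -/
lemma integral_one_sub_cos_mul_cexp_eq_stableExponent {α : ℝ} (hα0 : 0 < α) (hα2 : α < 2)
    {s : ℝ} (hs : 0 ≤ s) (u : ℝ) :
    2 * tailConst α * α * ∫ y in Ioi (0 : ℝ),
        ((y ^ (-α - 1) * (1 - Real.cos (s * y)) : ℝ) : ℂ) * Complex.exp (u * y * Complex.I)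
      = (stableExponent α (u + s) + stableExponent α (u - s)) / 2 - stableExponent α u := by
  by_cases hα1 : α = 1
  · subst hα1
    have hslit : ∀ z : ℂ, 0 < z.re → z ∈ Complex.slitPlane := fun z hz => Or.inl hz
    have hP : ∀ z : ℂ, 0 < z.re →
        HasDerivAt (fun z : ℂ => z * Complex.log z) (Complex.log z + 1) z := by
      intro z hz
      have h0 : z ≠ 0 := Complex.slitPlane_ne_zero (hslit z hz)
      convert! (hasDerivAt_id z).mul (Complex.hasDerivAt_log (hslit z hz)) using 1
      simp [h0]
    have hP' : ∀ z : ℂ, 0 < z.re → HasDerivAt (fun z : ℂ => Complex.log z + 1)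
        (z ^ (((1 : ℝ) : ℂ) - 2)) z := by
      intro z hz
      convert! (Complex.hasDerivAt_log (hslit z hz)).add_const 1 using 1
      rw [← Complex.cpow_neg_one]; congr 1; push_cast; ring
    rw [integral_one_sub_cos_mul_cexp hα0 hα2 hs hP hP' (fun z hz => continuousAt_mul_log hz)]
    -- At `α = 1` the second antiderivative `z log z` plays the role of the power, and the `-2/π` in
    -- `omega` comes from this constant.
    have hv : ∀ v : ℝ, -(v : ℂ) * Complex.I * Complex.log (-(v : ℂ) * Complex.I)
        = -(Real.pi / 2) * stableExponent 1 v := by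
      intro v
      rcases eq_or_ne v 0 with rfl | hv
      · simp [stableExponent]
      · rw [log_neg_mul_I hv, stableExponent, omega, if_pos rfl]
        have hpi : (Real.pi : ℂ) ≠ 0 := by exact_mod_cast Real.pi_ne_zero
        rcases hv.lt_or_gt with h | h
        · rw [Real.sign_of_neg h, abs_of_neg h, Real.rpow_one]
          push_cast
          field_simp
          ring_nf
          simp only [Complex.I_sq]
          ring
        · rw [Real.sign_of_pos h, abs_of_pos h, Real.rpow_one]
          push_cast
          field_simp
          ring_nf
          simp only [Complex.I_sq]
          ring
    rw [hv, hv, hv, tailConst]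
    have hpi : (Real.pi : ℂ) ≠ 0 := by exact_mod_cast Real.pi_ne_zero
    norm_num
    field_simp
    ring
  · have hslit : ∀ z : ℂ, 0 < z.re → z ∈ Complex.slitPlane := fun z hz => Or.inl hz
    have ha : (α : ℂ) ≠ 0 := by exact_mod_cast hα0.ne'
    have ha1 : (α : ℂ) - 1 ≠ 0 := by
      rw [sub_ne_zero]; exact_mod_cast hα1
    have hP : ∀ z : ℂ, 0 < z.re → HasDerivAt (fun z : ℂ => z ^ (α : ℂ) / (α * (α - 1)))
        (z ^ ((α : ℂ) - 1) / (α - 1)) z := by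
      intro z hz
      convert! ((hasDerivAt_id z).cpow_const (c := (α : ℂ)) (hslit z hz)).div_const
        ((α : ℂ) * (α - 1)) using 1
      simp only [id]
      field_simp
    have hP' : ∀ z : ℂ, 0 < z.re → HasDerivAt (fun z : ℂ => z ^ ((α : ℂ) - 1) / (α - 1))
        (z ^ ((α : ℂ) - 2)) z := by
      intro z hz
      convert! ((hasDerivAt_id z).cpow_const (c := (α : ℂ) - 1) (hslit z hz)).div_const
        ((α : ℂ) - 1) using 1
      simp only [id]
      field_simp
      congr 1; ring
    have hPc : ∀ z : ℂ, 0 ≤ z.re →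
        ContinuousAt (fun z : ℂ => z ^ (α : ℂ) / (α * (α - 1))) z := by
      intro z hz
      refine ContinuousAt.div_const ?_ _
      exact (Complex.continuousAt_cpow_of_re_pos (p := (z, (α : ℂ))) (Or.inl hz) (by simpa)).comp
        (f := fun z : ℂ => (z, (α : ℂ))) (by fun_prop)
    rw [integral_one_sub_cos_mul_cexp hα0 hα2 hs hP hP' hPc]
    simp only [cpow_neg_mul_I hα0 hα2 hα1]
    -- This is Euler's reflection formula combined with the sine duplication formula; it is what
    -- fixes the value of `C_α`.
    have key : 2 * tailConst α * α * (Real.Gamma (2 - α) * Real.cos (Real.pi * α / 2)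
        / (α * (α - 1))) = -1 := by
      have hne : α - 1 ≠ 0 := sub_ne_zero.2 hα1
      have hrefl := Real.Gamma_mul_Gamma_one_sub α
      have hΓ : Real.Gamma (2 - α) = (1 - α) * Real.Gamma (1 - α) := by
        rw [← Real.Gamma_add_one (by intro h; exact hne (by linarith))]; congr 1; ring
      have hsin : Real.sin (Real.pi * α)
          = 2 * Real.sin (Real.pi * α / 2) * Real.cos (Real.pi * α / 2) := by
        rw [← Real.sin_two_mul]; congr 1; ring
      have hs0 : Real.sin (Real.pi * α) ≠ 0 := by
        intro h
        rw [Real.sin_eq_zero_iff] at h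
        obtain ⟨n, hn⟩ := h
        have hn' : (n : ℝ) = α := by
          have := Real.pi_pos.ne'
          field_simp at hn
          linarith
        have h1 : (0 : ℤ) < n := by exact_mod_cast (by linarith : (0 : ℝ) < n)
        have h2 : n < (2 : ℤ) := by exact_mod_cast (by linarith : (n : ℝ) < 2)
        have : n = 1 := by omega
        subst this
        exact hα1 (by rw [← hn']; simp)
      have hpi := Real.pi_ne_zero
      rw [eq_div_iff hs0, hsin] at hrefl
      rw [tailConst, hΓ, show α * Real.pi / 2 = Real.pi * α / 2 by ring]
      field_simp
      linear_combination (1 - α) * hrefl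
    have key' : (2 : ℂ) * tailConst α * α * (Real.Gamma (2 - α) * Real.cos (Real.pi * α / 2)
        / (α * (α - 1))) = -1 := by exact_mod_cast key
    linear_combination (stableExponent α u - (stableExponent α (u + s) +
      stableExponent α (u - s)) / 2) * key'

/-! ### From characteristic functions to tails -/

/-- Pointwise convergence of the characteristic functions of finite measures implies weak
convergence. -/
lemma tendsto_finiteMeasure_of_tendsto_charFun {ν : ℕ → FiniteMeasure ℝ} {ν₀ : FiniteMeasure ℝ}
    (h0 : ν₀ ≠ 0)
    (h : ∀ t : ℝ, Tendsto (fun n => charFun (ν n : Measure ℝ) t) atTop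
      (𝓝 (charFun (ν₀ : Measure ℝ) t))) :
    Tendsto ν atTop (𝓝 ν₀) := by
  -- The total mass is the characteristic function at `0`; after normalization Lévy's continuity
  -- theorem for probability measures applies.
  have hmass : Tendsto (fun n => (ν n).mass) atTop (𝓝 ν₀.mass) := by
    have h1 := (Complex.continuous_re.tendsto _).comp (h 0)
    simp only [Function.comp_def, charFun_zero, Complex.ofReal_re] at h1
    rw [← NNReal.tendsto_coe]
    exact h1
  refine FiniteMeasure.tendsto_of_tendsto_normalize_testAgainstNN_of_tendsto_mass ?_ hmass
  refine ProbabilityMeasure.tendsto_of_tendsto_charFun fun t => ?_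
  have hm0 : ν₀.mass ≠ 0 := ν₀.mass_nonzero_iff.2 h0
  have hc : ∀ m : FiniteMeasure ℝ, m ≠ 0 → charFun (m.normalize : Measure ℝ) t
      = ((m.mass : ℝ) : ℂ)⁻¹ * charFun (m : Measure ℝ) t := by
    intro m hm
    rw [m.toMeasure_normalize_eq_of_nonzero hm, charFun_apply, charFun_apply]
    simp only [integral_smul_nnreal_measure]
    rw [NNReal.smul_def, Complex.real_smul]
    push_cast
    rfl
  rw [hc ν₀ h0]
  have hev : ∀ᶠ n in atTop, ν n ≠ 0 := by
    filter_upwards [hmass.eventually_ne hm0] with n hn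
    exact (ν n).mass_nonzero_iff.1 hn
  refine Tendsto.congr' (f₁ := fun n => (((ν n).mass : ℝ) : ℂ)⁻¹ * charFun (ν n : Measure ℝ) t)
    (hev.mono fun n hn => (hc _ hn).symm) ?_
  refine Tendsto.mul (Tendsto.inv₀ ?_ (by exact_mod_cast hm0)) (h t)
  exact (Complex.continuous_ofReal.tendsto _).comp (NNReal.tendsto_coe.2 hmass)

/-- Convergence of characteristic functions yields convergence of the integrals of a positive
continuous function over continuity sets. -/
lemma tendsto_setIntegral_of_tendsto_charFun {ν : ℕ → Measure ℝ} {ν₀ : Measure ℝ}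
    [∀ n, IsFiniteMeasure (ν n)] [IsFiniteMeasure ν₀] (h0 : ν₀ ≠ 0)
    (h : ∀ t : ℝ, Tendsto (fun n => charFun (ν n) t) atTop (𝓝 (charFun ν₀ t)))
    {g : ℝ → ℝ} (hg : Continuous g) (hg0 : ∀ y, 0 < g y) {C : ℝ} (hgC : ∀ y, g y ≤ C)
    {E : Set ℝ} (hE : MeasurableSet E) (hfr : ν₀ (frontier E) = 0) :
    Tendsto (fun n => ∫ y in E, g y ∂(ν n)) atTop (𝓝 (∫ y in E, g y ∂ν₀)) := by
  have hgm := hg.measurable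
  have hgi : ∀ (m : Measure ℝ) [IsFiniteMeasure m], Integrable g m := fun m _ =>
    Integrable.mono' (integrable_const C) hgm.aestronglyMeasurable
      (Eventually.of_forall fun y => by rw [Real.norm_of_nonneg (hg0 y).le]; exact hgC y)
  have hfin : ∀ (m : Measure ℝ) [IsFiniteMeasure m],
      IsFiniteMeasure (m.withDensity fun y => ENNReal.ofReal (g y)) := fun m _ =>
    isFiniteMeasure_withDensity_ofReal (hgi m).2
  let M : ℕ → FiniteMeasure ℝ := fun n => ⟨ν n, inferInstance⟩
  let M₀ : FiniteMeasure ℝ := ⟨ν₀, inferInstance⟩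
  let Q : ℕ → FiniteMeasure ℝ := fun n => ⟨_, hfin (ν n)⟩
  let Q₀ : FiniteMeasure ℝ := ⟨_, hfin ν₀⟩
  have hM0 : M₀ ≠ 0 := fun hh => h0 (congrArg Subtype.val hh)
  have hM : Tendsto M atTop (𝓝 M₀) := tendsto_finiteMeasure_of_tendsto_charFun hM0 h
  have hint : ∀ (m : Measure ℝ) (f : ℝ → ℝ),
      ∫ y, f y ∂(m.withDensity fun y => ENNReal.ofReal (g y)) = ∫ y, g y * f y ∂m := by
    intro m f
    rw [integral_withDensity_eq_integral_toReal_smul (by fun_prop) (by simp)]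
    simp [ENNReal.toReal_ofReal (hg0 _).le]
  let G : BoundedContinuousFunction ℝ ℝ := BoundedContinuousFunction.ofNormedAddCommGroup g hg C
    fun y => by rw [Real.norm_of_nonneg (hg0 y).le]; exact hgC y
  have hQ : Tendsto Q atTop (𝓝 Q₀) := by
    rw [FiniteMeasure.tendsto_iff_forall_integral_tendsto] at hM ⊢
    intro f
    have := hM (G * f)
    simpa [Q, Q₀, M, M₀, hint, G] using this
  have hset : ∀ (m : Measure ℝ) [IsFiniteMeasure m],
      (m.withDensity fun y => ENNReal.ofReal (g y)).real E = ∫ y in E, g y ∂m := by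
    intro m _
    rw [measureReal_def, withDensity_apply _ hE,
      integral_eq_lintegral_of_nonneg_ae (Eventually.of_forall fun y => (hg0 y).le) (by fun_prop)]
  -- Normalizing requires a nonzero limit, which is why `g` is strictly positive.
  have hQ0 : Q₀ ≠ 0 := by
    intro hh
    have h1 : ν₀.withDensity (fun y => ENNReal.ofReal (g y)) = 0 := congrArg Subtype.val hh
    rw [withDensity_eq_zero_iff (by fun_prop)] at h1
    have : ∀ᵐ y ∂ν₀, False := by
      filter_upwards [h1] with y hy
      have := hg0 y
      simp at hy
      linarith
    simp at this
    exact h0 this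
  have hn := (FiniteMeasure.tendsto_normalize_iff_tendsto hQ0).2 hQ
  have hfr' : (Q₀.normalize : Measure ℝ) (frontier E) = 0 := by
    rw [Q₀.toMeasure_normalize_eq_of_nonzero hQ0]
    have : (Q₀ : Measure ℝ) (frontier E) = 0 := withDensity_absolutelyContinuous _ _ hfr
    simp [this]
  have hp := ProbabilityMeasure.tendsto_measure_of_null_frontier_of_tendsto hn.1
    (E := E) (by simpa using hfr')
  have hmul := hn.2.mul hp
  simp only [← FiniteMeasure.self_eq_mass_mul_normalize] at hmul
  have hreal := NNReal.tendsto_coe.2 hmul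
  simp only [← hset]
  exact hreal

/-- Summation of the dyadic blocks of a regularly varying tail. -/
lemma tendsto_rpow_mul_measureReal_Ioi {ρ : Measure ℝ} [IsFiniteMeasure ρ] {α L : ℝ} (hα : 0 < α)
    (h : Tendsto (fun x : ℝ => x ^ α * ρ.real (Ioc x (2 * x))) atTop (𝓝 (L * (1 - 2 ^ (-α))))) :
    Tendsto (fun x : ℝ => x ^ α * ρ.real (Ioi x)) atTop (𝓝 L) := by
  set G : ℝ → ℝ := fun x => x ^ α * ρ.real (Ioc x (2 * x)) with hG
  set q : ℝ := 2 ^ (-α) with hq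
  have hq0 : 0 < q := by positivity
  have hq1 : q < 1 := Real.rpow_lt_one_of_one_lt_of_neg one_lt_two (by linarith)
  have hsum : ∀ x : ℝ, 0 < x → x ^ α * ρ.real (Ioi x) = ∑' k : ℕ, q ^ k * G (2 ^ k * x) := by
    intro x hx
    have hU : Ioi x = ⋃ k : ℕ, Ioc (2 ^ k * x) (2 ^ (k + 1) * x) := by
      have hm : Monotone fun k : ℕ => (2 : ℝ) ^ k * x := fun a b hab =>
        mul_le_mul_of_nonneg_right (pow_le_pow_right₀ one_le_two hab) hx.le
      ext y
      simp only [mem_Ioi, mem_iUnion, mem_Ioc]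
      constructor
      · intro hy
        have hex : ∃ k : ℕ, y ≤ 2 ^ k * x := by
          obtain ⟨k, hk⟩ := pow_unbounded_of_one_lt (y / x) (one_lt_two (α := ℝ))
          exact ⟨k, by rw [div_lt_iff₀ hx] at hk; exact hk.le⟩
        classical
        have hk := Nat.find_spec hex
        have hk0 : Nat.find hex ≠ 0 := by
          intro h0
          rw [h0] at hk
          simp at hk
          linarith
        obtain ⟨j, hj⟩ := Nat.exists_eq_succ_of_ne_zero hk0
        refine ⟨j, ?_, ?_⟩
        · have := Nat.find_min hex (m := j) (by omega)
          exact not_le.1 this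
        · rw [hj] at hk; exact hk
      · rintro ⟨k, hk, -⟩
        refine lt_of_le_of_lt ?_ hk
        have := hm (Nat.zero_le k)
        simpa using this
    have hdis : Pairwise (Function.onFun Disjoint
        fun k : ℕ => Ioc ((2 : ℝ) ^ k * x) (2 ^ (k + 1) * x)) := by
      have hm : Monotone fun k : ℕ => (2 : ℝ) ^ k * x := fun a b hab =>
        mul_le_mul_of_nonneg_right (pow_le_pow_right₀ one_le_two hab) hx.le
      exact hm.pairwise_disjoint_on_Ioc_succ
    rw [hU, measureReal_def, measure_iUnion hdis (fun k => measurableSet_Ioc),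
      ENNReal.tsum_toReal_eq (fun k => measure_ne_top _ _), ← tsum_mul_left]
    refine tsum_congr fun k => ?_
    simp only [hG, ← measureReal_def]
    rw [Real.mul_rpow (by positivity) hx.le, ← Real.rpow_natCast 2 k, ← Real.rpow_mul (by norm_num),
      hq, ← Real.rpow_natCast _ k, ← Real.rpow_mul (by norm_num)]
    have e1 : (2 : ℝ) ^ (-α * k) * 2 ^ (k * α) = 1 := by
      rw [← Real.rpow_add two_pos]; simp [mul_comm]
    have e2 : (2 : ℝ) ^ (k + 1) * x = 2 * (2 ^ (k : ℝ) * x) := by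
      rw [Real.rpow_natCast]; ring
    rw [e2, Real.rpow_natCast 2 k]
    linear_combination (-(x ^ α * ρ.real (Ioc (2 ^ k * x) (2 * (2 ^ k * x))))) * e1
  -- The factor `1 - 2 ^ (-α)` in the hypothesis is exactly what the geometric series cancels.
  have hlim : ∑' k : ℕ, q ^ k * (L * (1 - q)) = L := by
    rw [tsum_mul_right, tsum_geometric_of_lt_one hq0.le hq1]
    field_simp [(sub_pos.2 hq1).ne']
  -- Past `x₀` every block `2 ^ k * x` obeys one bound, so a geometric series dominates the sum.
  obtain ⟨x₀, hx₀⟩ := eventually_atTop.1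
    (h.norm.eventually (gt_mem_nhds (lt_add_one ‖L * (1 - q)‖)))
  have key : Tendsto (fun x : ℝ => ∑' k : ℕ, q ^ k * G (2 ^ k * x)) atTop
      (𝓝 (∑' k : ℕ, q ^ k * (L * (1 - q)))) := by
    refine tendsto_tsum_of_dominated_convergence
      (bound := fun k => q ^ k * (‖L * (1 - q)‖ + 1)) ?_ ?_ ?_
    · exact (summable_geometric_of_lt_one hq0.le hq1).mul_right _
    · intro k
      refine Tendsto.const_mul _ (h.comp ?_)
      exact tendsto_id.const_mul_atTop (by positivity)
    · filter_upwards [eventually_ge_atTop x₀, eventually_ge_atTop 0] with x hx hx' k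
      rw [norm_mul, Real.norm_of_nonneg (by positivity : 0 ≤ q ^ k)]
      refine mul_le_mul_of_nonneg_left (hx₀ _ ?_).le (by positivity)
      have : (1 : ℝ) ≤ 2 ^ k := one_le_pow₀ one_le_two
      nlinarith
  rw [hlim] at key
  refine key.congr' ?_
  filter_upwards [eventually_gt_atTop 0] with x hx using (hsum x hx).symm

/-! ### Tails of a totally skewed stable law -/

/-- The law of `y / x`, weighted by `x ^ α (1 - cos y)`. -/
def rescaledLaw (ρ : Measure ℝ) (α x : ℝ) : Measure ℝ :=
  ENNReal.ofReal (x ^ α) •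
    (ρ.map fun y => x⁻¹ * y).withDensity fun y => ENNReal.ofReal (1 - Real.cos y)

/-- The Lévy measure `2 C_α α c y ^ (-α - 1) dy` on `(0, ∞)`, weighted by `1 - cos y`. -/
def limitLaw (α c : ℝ) : Measure ℝ :=
  (volume.restrict (Ioi 0)).withDensity fun y =>
    ENNReal.ofReal (2 * tailConst α * α * c * (y ^ (-α - 1) * (1 - Real.cos y)))

lemma one_sub_cos_nonneg (y : ℝ) : 0 ≤ 1 - Real.cos y := by linarith [Real.cos_le_one y]

lemma tailConst_pos {α : ℝ} (hα0 : 0 < α) (hα2 : α < 2) : 0 < tailConst α := by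
  have h1 := Real.Gamma_pos_of_pos hα0
  have h2 : 0 < Real.sin (α * Real.pi / 2) :=
    Real.sin_pos_of_pos_of_lt_pi (by positivity) (by nlinarith [Real.pi_pos])
  unfold tailConst
  positivity

instance isFiniteMeasure_rescaledLaw (ρ : Measure ℝ) [IsFiniteMeasure ρ] (α x : ℝ) :
    IsFiniteMeasure (rescaledLaw ρ α x) := by
  have hb : Integrable (fun y => 1 - Real.cos y) (ρ.map fun y => x⁻¹ * y) := by
    refine Integrable.mono' (integrable_const 2) (by fun_prop) (Eventually.of_forall fun y => ?_)
    rw [Real.norm_of_nonneg (one_sub_cos_nonneg y)]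
    linarith [Real.neg_one_le_cos y]
  have : IsFiniteMeasure ((ρ.map fun y => x⁻¹ * y).withDensity
      fun y => ENNReal.ofReal (1 - Real.cos y)) := isFiniteMeasure_withDensity_ofReal hb.2
  exact Measure.smul_finite _ ENNReal.ofReal_ne_top

lemma isFiniteMeasure_limitLaw {α : ℝ} (hα0 : 0 < α) (hα2 : α < 2) (c : ℝ) :
    IsFiniteMeasure (limitLaw α c) := by
  refine isFiniteMeasure_withDensity_ofReal (Integrable.const_mul ?_ _).2
  have h := integrableOn_one_sub_cos_mul_rpow hα0 hα2 1
  simp only [one_mul] at h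
  exact h

lemma integral_rescaledLaw {F : Type*} [NormedAddCommGroup F] [NormedSpace ℝ F] (ρ : Measure ℝ)
    {α x : ℝ} (hx : 0 < x) (f : ℝ → F) :
    ∫ y, f y ∂(rescaledLaw ρ α x)
      = x ^ α • ∫ y, (1 - Real.cos y) • f y ∂(ρ.map fun y => x⁻¹ * y) := by
  rw [rescaledLaw, integral_smul_measure, ENNReal.toReal_ofReal (by positivity),
    integral_withDensity_eq_integral_toReal_smul (by fun_prop) (by simp)]
  simp [ENNReal.toReal_ofReal (one_sub_cos_nonneg _)]

/-- Writing the cosine with exponentials, the weight shifts the frequency by `±1`. -/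
lemma charFun_rescaledLaw (ρ : Measure ℝ) [IsFiniteMeasure ρ] {α x : ℝ} (hx : 0 < x) (u : ℝ) :
    charFun (rescaledLaw ρ α x) u = ((x ^ α : ℝ) : ℂ) * (charFun ρ (x⁻¹ * u)
      - (charFun ρ (x⁻¹ * (u + 1)) + charFun ρ (x⁻¹ * (u - 1))) / 2) := by
  have hi : ∀ v : ℝ, Integrable (fun y : ℝ => Complex.exp (v * y * Complex.I))
      (ρ.map fun y => x⁻¹ * y) := by
    intro v
    refine Integrable.mono' (integrable_const (1 : ℝ)) (by fun_prop)
      (Eventually.of_forall fun y => ?_)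
    rw [← Complex.ofReal_mul, Complex.norm_exp_ofReal_mul_I]
  rw [charFun_apply_real, integral_rescaledLaw ρ hx, ← charFun_map_mul, ← charFun_map_mul,
    ← charFun_map_mul, charFun_apply_real, charFun_apply_real, charFun_apply_real,
    ← integral_add (hi _) (hi _), ← integral_div, ← integral_sub (hi _) ?_, Complex.real_smul]
  swap
  · exact ((hi _).add (hi _)).div_const 2
  congr 2
  ext y
  rw [Complex.real_smul]
  have hc : ((1 - Real.cos y : ℝ) : ℂ)
      = 1 - (Complex.exp (y * Complex.I) + Complex.exp (-y * Complex.I)) / 2 := by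
    rw [Complex.ofReal_sub, Complex.ofReal_cos, Complex.cos]; push_cast; rfl
  have e1 : Complex.exp (((u + 1 : ℝ) : ℂ) * y * Complex.I)
      = Complex.exp (u * y * Complex.I) * Complex.exp (y * Complex.I) := by
    rw [← Complex.exp_add]; congr 1; push_cast; ring
  have e2 : Complex.exp (((u - 1 : ℝ) : ℂ) * y * Complex.I)
      = Complex.exp (u * y * Complex.I) * Complex.exp (-y * Complex.I) := by
    rw [← Complex.exp_add]; congr 1; push_cast; ring
  rw [hc, e1, e2]
  ring

lemma integral_limitLaw {F : Type*} [NormedAddCommGroup F] [NormedSpace ℝ F]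
    {α c : ℝ} (hα0 : 0 < α) (hα2 : α < 2) (hc : 0 ≤ c) (f : ℝ → F) :
    ∫ y, f y ∂(limitLaw α c)
      = ∫ y in Ioi 0, (2 * tailConst α * α * c * (y ^ (-α - 1) * (1 - Real.cos y))) • f y := by
  rw [limitLaw, integral_withDensity_eq_integral_toReal_smul (by fun_prop) (by simp)]
  refine setIntegral_congr_fun measurableSet_Ioi fun y hy => ?_
  have h0 : 0 < y := hy
  have h1 := tailConst_pos hα0 hα2
  have h2 := one_sub_cos_nonneg y
  have h3 : 0 ≤ 2 * tailConst α * α * c * (y ^ (-α - 1) * (1 - Real.cos y)) := by positivity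
  simp only [ENNReal.toReal_ofReal h3]

lemma charFun_limitLaw {α c : ℝ} (hα0 : 0 < α) (hα2 : α < 2) (hc : 0 ≤ c) (u : ℝ) :
    charFun (limitLaw α c) u
      = c * ((stableExponent α (u + 1) + stableExponent α (u - 1)) / 2 - stableExponent α u) := by
  rw [charFun_apply_real, integral_limitLaw hα0 hα2 hc,
    ← integral_one_sub_cos_mul_cexp_eq_stableExponent hα0 hα2 zero_le_one, ← mul_assoc,
    ← integral_const_mul]
  congr 1
  ext y
  rw [Complex.real_smul]
  push_cast
  simp only [one_mul]
  ring

/-- The total mass, read off at frequency `0`, is `c`, because the skew parts of the exponent at `1`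
and `-1` cancel. -/
lemma limitLaw_ne_zero {α c : ℝ} (hα0 : 0 < α) (hα2 : α < 2) (hc : 0 < c) : limitLaw α c ≠ 0 := by
  intro h
  have h1 := charFun_limitLaw hα0 hα2 hc.le 0
  have h2 : (c : ℂ) ≠ 0 := by exact_mod_cast hc.ne'
  rw [h] at h1
  have hs : stableExponent α 1 + stableExponent α (-1) = 2 := by
    simp only [stableExponent, omega, abs_neg, abs_one, Real.one_rpow, Real.log_one,
      Real.sign_of_pos one_pos, Real.sign_of_neg (by norm_num : (-1 : ℝ) < 0)]
    push_cast
    ring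
  have h0 : stableExponent α 0 = 0 := by simp [stableExponent, hα0.ne']
  simp [hs, h0] at h1
  exact h2 h1.symm

/-- The stable exponent is homogeneous up to a linear term. -/
lemma exists_stableExponent_scaling {α : ℝ} (hα2 : α < 2) :
    ∃ b : ℝ → ℝ, Tendsto (fun x => x ^ (-(α / 2)) * b x) atTop (𝓝 0) ∧
      ∀ x v : ℝ, 0 < x → ((x ^ α : ℝ) : ℂ) * stableExponent α (x⁻¹ * v)
        = stableExponent α v - Complex.I * ((b x * v : ℝ) : ℂ) := by
  have hsign : ∀ x v : ℝ, 0 < x → Real.sign (x⁻¹ * v) = Real.sign v := by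
    intro x v hx
    have hx' := inv_pos.2 hx
    rcases lt_trichotomy v 0 with h | rfl | h
    · rw [Real.sign_of_neg h, Real.sign_of_neg (mul_neg_of_pos_of_neg hx' h)]
    · simp
    · rw [Real.sign_of_pos h, Real.sign_of_pos (mul_pos hx' h)]
  have hpow : ∀ x v : ℝ, 0 < x → x ^ α * |x⁻¹ * v| ^ α = |v| ^ α := by
    intro x v hx
    rw [← Real.mul_rpow hx.le (abs_nonneg _), abs_mul, abs_of_pos (inv_pos.2 hx), ← mul_assoc,
      mul_inv_cancel₀ hx.ne', one_mul]
  by_cases hα1 : α = 1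
  · subst hα1
    refine ⟨fun x => 2 / Real.pi * Real.log x, ?_, ?_⟩
    · have h := (isLittleO_log_rpow_atTop (show (0 : ℝ) < 1 / 2 by norm_num)).tendsto_div_nhds_zero
      have h' := h.const_mul (2 / Real.pi)
      rw [mul_zero] at h'
      refine h'.congr' ?_
      filter_upwards [eventually_gt_atTop 0] with x hx
      rw [Real.rpow_neg hx.le]
      ring
    · intro x v hx
      rcases eq_or_ne v 0 with rfl | hv
      · simp [stableExponent]
      · have hl : Real.log |x⁻¹ * v| = Real.log |v| - Real.log x := by
          rw [abs_mul, Real.log_mul (by simp [hx.ne']) (by simpa), abs_of_pos (inv_pos.2 hx),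
            Real.log_inv]
          ring
        have hvs : |v| * Real.sign v = v := by
          rcases hv.lt_or_gt with h | h
          · rw [Real.sign_of_neg h, abs_of_neg h]; ring
          · rw [Real.sign_of_pos h, abs_of_pos h]; ring
        simp only [stableExponent, omega, if_true]
        rw [hsign x v hx, hl, ← mul_assoc, ← Complex.ofReal_mul, hpow x v hx, Real.rpow_one]
        have hvs' : ((|v| : ℝ) : ℂ) * ((Real.sign v : ℝ) : ℂ) = v := by exact_mod_cast hvs
        push_cast
        linear_combination (-Complex.I * (2 / Real.pi) * Real.log x) * hvs'
  · refine ⟨fun _ => 0, by simp, ?_⟩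
    intro x v hx
    simp only [stableExponent, omega, if_neg hα1]
    rw [hsign x v hx, ← mul_assoc, ← Complex.ofReal_mul, hpow x v hx]
    simp

/-- Expand `exp W` to first order: the constant `1` and the drift cancel in the second difference,
the homogeneous part of `W` gives the limit, and the quadratic remainder is negligible. -/
lemma tendsto_charFun_rescaledLaw {ρ : Measure ℝ} [IsFiniteMeasure ρ] {α γ δ : ℝ}
    (hα0 : 0 < α) (hα2 : α < 2) (hγ : 0 < γ)
    (hρ : ∀ u : ℝ, charFun ρ u = stableCharFun α 1 γ δ u) (u : ℝ) :
    Tendsto (fun x : ℝ => charFun (rescaledLaw ρ α x) u) atTop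
      (𝓝 (charFun (limitLaw α (γ ^ α)) u)) := by
  obtain ⟨b, hb0, hb⟩ := exists_stableExponent_scaling hα2
  set c : ℝ := γ ^ α with hc
  have hc0 : 0 < c := by positivity
  set B : ℝ → ℝ := fun x => c * b x + δ * x ^ (α - 1) with hB
  set W : ℝ → ℝ → ℂ := fun x v =>
    -(c : ℂ) * stableExponent α (x⁻¹ * v) + Complex.I * ((δ * (x⁻¹ * v) : ℝ) : ℂ) with hW
  have hρW : ∀ x v, charFun ρ (x⁻¹ * v) = Complex.exp (W x v) := by
    intro x v
    rw [hρ, stableCharFun, hW, hc]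
    simp only [stableExponent]
    congr 1
    push_cast
    ring
  have hxW : ∀ x v : ℝ, 0 < x → ((x ^ α : ℝ) : ℂ) * W x v
      = -(c : ℂ) * stableExponent α v + Complex.I * ((B x * v : ℝ) : ℂ) := by
    intro x v hx
    have h1 := hb x v hx
    have h2 : x ^ α * x⁻¹ = x ^ (α - 1) := by
      rw [Real.rpow_sub hx, Real.rpow_one]; rfl
    have h2' : ((x ^ α : ℝ) : ℂ) * (x : ℂ)⁻¹ = ((x ^ (α - 1) : ℝ) : ℂ) := by exact_mod_cast h2
    simp only [hW, hB]
    push_cast at h1 ⊢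
    linear_combination (-(c : ℂ)) * h1 + Complex.I * δ * v * h2'
  have hBlim : Tendsto (fun x => x ^ (-(α / 2)) * B x) atTop (𝓝 0) := by
    have h1 : Tendsto (fun x : ℝ => x ^ (-(1 - α / 2))) atTop (𝓝 0) :=
      tendsto_rpow_neg_atTop (by linarith)
    have h2 := (hb0.const_mul c).add (h1.const_mul δ)
    simp only [mul_zero, add_zero] at h2
    refine h2.congr' ?_
    filter_upwards [eventually_gt_atTop 0] with x hx
    have : x ^ (-(1 - α / 2)) = x ^ (-(α / 2)) * x ^ (α - 1) := by
      rw [← Real.rpow_add hx]; congr 1; ring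
    rw [this, hB]
    ring
  -- The drift `B` may be unbounded, so `x ^ α * W` need not stay bounded. The weaker scale `x ^ (α
  -- / 2)`, where the drift vanishes because `α < 2`, is all that a quadratic remainder needs.
  have hhalf : ∀ v, Tendsto (fun x : ℝ => ((x ^ (α / 2) : ℝ) : ℂ) * W x v) atTop (𝓝 0) := by
    intro v
    have h1 : Tendsto (fun x : ℝ => ((x ^ (-(α / 2)) : ℝ) : ℂ)) atTop (𝓝 ((0 : ℝ) : ℂ)) :=
      (Complex.continuous_ofReal.tendsto _).comp (tendsto_rpow_neg_atTop (by linarith))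
    have h2 : Tendsto (fun x : ℝ => ((x ^ (-(α / 2)) * B x : ℝ) : ℂ)) atTop (𝓝 ((0 : ℝ) : ℂ)) :=
      (Complex.continuous_ofReal.tendsto _).comp hBlim
    have h3 := (h1.mul_const (-(c : ℂ) * stableExponent α v)).add (h2.mul_const (Complex.I * v))
    simp only [Complex.ofReal_zero, zero_mul, add_zero] at h3
    refine h3.congr' ?_
    filter_upwards [eventually_gt_atTop 0] with x hx
    have h4 : x ^ (α / 2) = x ^ (-(α / 2)) * x ^ α := by
      rw [← Real.rpow_add hx]; congr 1; ring
    have h5 := hxW x v hx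
    rw [h4]
    push_cast at h5 ⊢
    linear_combination (-((x ^ (-(α / 2)) : ℝ) : ℂ)) * h5
  have hW0 : ∀ v, Tendsto (fun x : ℝ => W x v) atTop (𝓝 0) := by
    intro v
    have h1 : Tendsto (fun x : ℝ => ((x ^ (-(α / 2)) : ℝ) : ℂ)) atTop (𝓝 ((0 : ℝ) : ℂ)) :=
      (Complex.continuous_ofReal.tendsto _).comp (tendsto_rpow_neg_atTop (by linarith))
    have h2 := h1.mul (hhalf v)
    rw [mul_zero] at h2
    refine h2.congr' ?_
    filter_upwards [eventually_gt_atTop 0] with x hx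
    have h4 : x ^ (-(α / 2)) * x ^ (α / 2) = 1 := by
      rw [← Real.rpow_add hx]; simp
    rw [← mul_assoc, ← Complex.ofReal_mul, h4]
    simp
  have hrem : ∀ v, Tendsto (fun x : ℝ => ((x ^ α : ℝ) : ℂ) * (Complex.exp (W x v) - 1 - W x v))
      atTop (𝓝 0) := by
    intro v
    have h1 : Tendsto (fun x : ℝ => ‖((x ^ (α / 2) : ℝ) : ℂ) * W x v‖ ^ 2) atTop (𝓝 0) := by
      simpa using ((hhalf v).norm.pow 2)
    refine squeeze_zero_norm' ?_ h1
    have h2 : ∀ᶠ x in atTop, ‖W x v‖ < 1 := by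
      have := (hW0 v).norm
      rw [norm_zero] at this
      exact this.eventually (gt_mem_nhds one_pos)
    filter_upwards [h2, eventually_gt_atTop 0] with x hx hx0
    have h3 := Complex.norm_exp_sub_one_sub_id_le hx.le
    have h4 : x ^ α = (x ^ (α / 2)) ^ 2 := by
      rw [← Real.rpow_natCast, ← Real.rpow_mul hx0.le]; congr 1; push_cast; ring
    have h5 : 0 ≤ x ^ (α / 2) := by positivity
    rw [norm_mul, norm_mul, Complex.norm_real, Complex.norm_real, Real.norm_of_nonneg h5,
      Real.norm_of_nonneg (by positivity), mul_pow, ← h4]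
    gcongr
  rw [charFun_limitLaw hα0 hα2 hc0.le]
  have hfin := (((hrem u).sub (((hrem (u + 1)).add (hrem (u - 1))).div_const 2)).add
    (tendsto_const_nhds (x := (c : ℂ) * ((stableExponent α (u + 1) + stableExponent α (u - 1)) / 2
      - stableExponent α u))))
  simp only [add_zero, zero_div, sub_zero, zero_add] at hfin
  refine hfin.congr' ?_
  filter_upwards [eventually_gt_atTop 0] with x hx
  rw [charFun_rescaledLaw ρ hx, hρW, hρW, hρW]
  have a0 := hxW x u hx
  have a1 := hxW x (u + 1) hx
  have a2 := hxW x (u - 1) hx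
  push_cast at a0 a1 a2 ⊢
  linear_combination (-1 : ℂ) * a0 + (a1 + a2) / 2

/-- `1 / (1 - cos y)`, capped away from `1 ≤ |y| ≤ 2`. -/
def cappedInv (y : ℝ) : ℝ := (max (1 - Real.cos y) (1 - Real.cos 1))⁻¹

lemma one_sub_cos_one_pos : 0 < 1 - Real.cos 1 := by
  have := Real.cos_lt_cos_of_nonneg_of_le_pi (x := 0) (y := 1) le_rfl
    (by linarith [Real.pi_gt_three]) one_pos
  rw [Real.cos_zero] at this
  linarith

lemma cappedInv_mul {y : ℝ} (h1 : 1 ≤ |y|) (h2 : |y| ≤ 2) :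
    (1 - Real.cos y) * cappedInv y = 1 := by
  have h : Real.cos y ≤ Real.cos 1 := by
    rw [← Real.cos_abs y]
    exact Real.cos_le_cos_of_nonneg_of_le_pi zero_le_one
      (by linarith [Real.pi_gt_three]) h1
  rw [cappedInv, max_eq_left (by linarith)]
  exact mul_inv_cancel₀ (by linarith [one_sub_cos_one_pos])

/-- On `1 ≤ |y| ≤ 2` the weight `1 - cos y` is bounded below, so integrating its capped inverse
recovers the unweighted mass. The set `E` stays general to serve both the right and the left tail;
its boundary is null because the limit has a density. -/
lemma tendsto_setIntegral_cappedInv {ρ : Measure ℝ} [IsFiniteMeasure ρ] {α γ δ : ℝ}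
    (hα0 : 0 < α) (hα2 : α < 2) (hγ : 0 < γ)
    (hρ : ∀ u : ℝ, charFun ρ u = stableCharFun α 1 γ δ u) {a b : ℝ} {E : Set ℝ}
    (hE : MeasurableSet E) (hfr : frontier E ⊆ {a, b}) (hE' : ∀ y ∈ E, 1 ≤ |y| ∧ |y| ≤ 2) :
    Tendsto (fun x : ℝ => x ^ α * ρ.real ((fun y => x⁻¹ * y) ⁻¹' E)) atTop
      (𝓝 (∫ y in E ∩ Ioi 0, 2 * tailConst α * α * γ ^ α * y ^ (-α - 1))) := by
  have hc : 0 < γ ^ α := by positivity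
  have hfinite := isFiniteMeasure_limitLaw hα0 hα2 (γ ^ α)
  have hg : Continuous cappedInv :=
    Continuous.inv₀ (by fun_prop) fun y => (lt_max_of_lt_right one_sub_cos_one_pos).ne'
  have hg0 : ∀ y, 0 < cappedInv y := fun y =>
    inv_pos.2 (lt_max_of_lt_right one_sub_cos_one_pos)
  have hgC : ∀ y, cappedInv y ≤ (1 - Real.cos 1)⁻¹ := fun y =>
    inv_anti₀ one_sub_cos_one_pos (le_max_right _ _)
  have hnull : limitLaw α (γ ^ α) (frontier E) = 0 := by
    refine measure_mono_null hfr ?_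
    refine withDensity_absolutelyContinuous _ _ ?_
    exact Measure.absolutelyContinuous_of_le Measure.restrict_le_self
      (((Set.finite_singleton b).insert a).measure_zero _)
  have hlim : ∫ y in E, cappedInv y ∂(limitLaw α (γ ^ α))
      = ∫ y in E ∩ Ioi 0, 2 * tailConst α * α * γ ^ α * y ^ (-α - 1) := by
    rw [← integral_indicator hE, integral_limitLaw hα0 hα2 hc.le, inter_comm,
      ← setIntegral_indicator hE]
    congr 1
    ext y
    by_cases hy : y ∈ E
    · rw [indicator_of_mem hy, indicator_of_mem hy, smul_eq_mul]
      have := cappedInv_mul (hE' y hy).1 (hE' y hy).2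
      linear_combination (2 * tailConst α * α * γ ^ α * y ^ (-α - 1)) * this
    · simp [hy]
  have hpre : ∀ x : ℝ, 0 < x → ∫ y in E, cappedInv y ∂(rescaledLaw ρ α x)
      = x ^ α * ρ.real ((fun y => x⁻¹ * y) ⁻¹' E) := by
    intro x hx
    rw [← integral_indicator hE, integral_rescaledLaw ρ hx, smul_eq_mul]
    congr 1
    have h1 : (fun y => (1 - Real.cos y) • E.indicator cappedInv y) = E.indicator 1 := by
      ext y
      by_cases hy : y ∈ E
      · rw [indicator_of_mem hy, indicator_of_mem hy, smul_eq_mul,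
          cappedInv_mul (hE' y hy).1 (hE' y hy).2]
        rfl
      · simp [hy]
    rw [h1, integral_indicator_one hE, measureReal_def, Measure.map_apply (by fun_prop) hE]
    rfl
  refine tendsto_of_seq_tendsto fun x hx => ?_
  have h := tendsto_setIntegral_of_tendsto_charFun (ν := fun n => rescaledLaw ρ α (x n))
    (limitLaw_ne_zero hα0 hα2 hc)
    (fun t => (tendsto_charFun_rescaledLaw hα0 hα2 hγ hρ t).comp hx) hg hg0 hgC hE hnull
  rw [hlim] at h
  refine h.congr' ?_
  filter_upwards [hx.eventually_gt_atTop 0] with n hn using hpre _ hn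

/-- The right tail of a totally skewed stable law. -/
lemma tendsto_rpow_mul_stable_Ioi {ρ : Measure ℝ} [IsFiniteMeasure ρ] {α γ δ : ℝ}
    (hα0 : 0 < α) (hα2 : α < 2) (hγ : 0 < γ)
    (hρ : ∀ u : ℝ, charFun ρ u = stableCharFun α 1 γ δ u) :
    Tendsto (fun x : ℝ => x ^ α * ρ.real (Ioi x)) atTop
      (𝓝 (2 * tailConst α * γ ^ α)) := by
  refine tendsto_rpow_mul_measureReal_Ioi hα0 ?_
  have h := tendsto_setIntegral_cappedInv (E := Ioc 1 2) (a := 1) (b := 2) hα0 hα2 hγ hρ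
    measurableSet_Ioc (by rw [frontier_Ioc one_lt_two]) (fun y hy => by
      rw [abs_of_pos (by linarith [hy.1])]; exact ⟨hy.1.le, hy.2⟩)
  have hI : ∫ y in Ioc 1 2 ∩ Ioi 0, 2 * tailConst α * α * γ ^ α * y ^ (-α - 1)
      = 2 * tailConst α * γ ^ α * (1 - 2 ^ (-α)) := by
    rw [inter_eq_left.2 (show Ioc (1 : ℝ) 2 ⊆ Ioi 0 from fun y hy => lt_trans one_pos hy.1),
      integral_const_mul, ← intervalIntegral.integral_of_le one_le_two,
      integral_rpow (Or.inr ⟨by linarith, by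
        rw [uIcc_of_le one_le_two]; simp⟩)]
    rw [show -α - 1 + 1 = -α by ring, Real.one_rpow]
    field_simp
    ring
  rw [hI] at h
  refine h.congr' ?_
  filter_upwards [eventually_gt_atTop 0] with x hx
  congr 2
  ext y
  simp only [mem_preimage, mem_Ioc]
  rw [← div_eq_inv_mul, lt_div_iff₀ hx, div_le_iff₀ hx, one_mul]

/-- The left tail of a stable law that is totally skewed to the right is negligible. -/
lemma tendsto_rpow_mul_stable_Iio {ρ : Measure ℝ} [IsFiniteMeasure ρ] {α γ δ : ℝ}
    (hα0 : 0 < α) (hα2 : α < 2) (hγ : 0 < γ)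
    (hρ : ∀ u : ℝ, charFun ρ u = stableCharFun α 1 γ δ u) :
    Tendsto (fun x : ℝ => x ^ α * ρ.real (Iio (-x))) atTop (𝓝 0) := by
  have hmap : ∀ A : Set ℝ, MeasurableSet A →
      (ρ.map fun y => -y).real A = ρ.real ((fun y => -y) ⁻¹' A) := by
    intro A hA
    rw [measureReal_def, Measure.map_apply (by fun_prop) hA]; rfl
  have h := tendsto_setIntegral_cappedInv (E := Ico (-2) (-1)) (a := -2) (b := -1) hα0 hα2 hγ hρ
    measurableSet_Ico (by rw [frontier_Ico (by norm_num)]) (fun y hy => by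
      rw [abs_of_neg (by linarith [hy.2])]
      exact ⟨by linarith [hy.2], by linarith [hy.1]⟩)
  -- The Lévy measure does not charge the negative half line, which makes the left blocks
  -- negligible.
  have hI : Ico (-2 : ℝ) (-1) ∩ Ioi 0 = ∅ := by
    ext y
    simp only [mem_inter_iff, mem_Ico, mem_Ioi, mem_empty_iff_false, iff_false]
    rintro ⟨⟨-, h1⟩, h2⟩
    linarith
  rw [hI, setIntegral_empty] at h
  have h2 := tendsto_rpow_mul_measureReal_Ioi (ρ := ρ.map fun y => -y) (L := 0) hα0 ?_
  · refine h2.congr fun x => ?_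
    rw [hmap _ measurableSet_Ioi]
    congr 2
    ext y
    simp only [mem_preimage, mem_Ioi, mem_Iio]
    constructor <;> intro h <;> linarith
  · rw [zero_mul]
    refine h.congr' ?_
    filter_upwards [eventually_gt_atTop 0] with x hx
    rw [hmap _ measurableSet_Ioc]
    congr 2
    ext y
    simp only [mem_preimage, mem_Ioc, mem_Ico]
    rw [← div_eq_inv_mul, le_div_iff₀ hx, div_lt_iff₀ hx]
    constructor <;> rintro ⟨h1, h2⟩ <;> constructor <;> linarith

/-! ### The single big jump principle -/

lemma eventually_mul_lt_one (M : ℝ) : ∀ᶠ η in 𝓝[>] (0 : ℝ), η * M < 1 := by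
  have : Continuous fun η : ℝ => η * M := by fun_prop
  have := this.tendsto 0
  simp only [zero_mul] at this
  exact (this.mono_left nhdsWithin_le_nhds).eventually (gt_mem_nhds one_pos)

section BigJump

variable {Ω ι τ : Type*} [MeasurableSpace Ω] {μ : Measure Ω} {α : ℝ} {l : Filter τ} {a : τ → ℝ}

lemma tendsto_rpow_mul_comp_const_mul {f : ℝ → ℝ} {L r : ℝ}
    (hf : Tendsto (fun x : ℝ => x ^ α * f x) atTop (𝓝 L)) (ha : Tendsto a l atTop) (hr : 0 < r) :
    Tendsto (fun t => a t ^ α * f (r * a t)) l (𝓝 (L * r ^ (-α))) := by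
  have h := (hf.comp (ha.const_mul_atTop hr)).mul_const (r ^ (-α))
  refine h.congr' ?_
  filter_upwards [ha.eventually_gt_atTop 0] with t ht
  have e : r ^ α * r ^ (-α) = 1 := by rw [← Real.rpow_add hr]; simp
  simp only [Function.comp]
  rw [Real.mul_rpow hr.le ht.le]
  linear_combination (a t ^ α * f (r * a t)) * e

/-- The tail of a nonnegative multiple of a random variable with regularly varying tail. -/
lemma tendsto_rpow_mul_tail_const_mul {X : Ω → ℝ} {c v r : ℝ} (hα : 0 < α)
    (hX : Tendsto (fun x : ℝ => x ^ α * μ.real {ω | x < X ω}) atTop (𝓝 c))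
    (ha : Tendsto a l atTop) (hv : 0 ≤ v) (hr : 0 < r) :
    Tendsto (fun t => a t ^ α * μ.real {ω | a t * r < v * X ω}) l
      (𝓝 (c * v ^ α * r ^ (-α))) := by
  rcases hv.eq_or_lt with rfl | hv
  · rw [Real.zero_rpow hα.ne', mul_zero, zero_mul]
    refine tendsto_const_nhds.congr' ?_
    filter_upwards [ha.eventually_gt_atTop 0] with t ht
    have : {ω | a t * r < 0 * X ω} = ∅ := by
      ext ω
      simpa using (mul_pos ht hr).le
    rw [this]
    simp
  · have h := tendsto_rpow_mul_comp_const_mul hX ha (div_pos hr hv)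
    have e : c * (r / v) ^ (-α) = c * v ^ α * r ^ (-α) := by
      rw [Real.div_rpow hr.le hv.le, Real.rpow_neg hv.le]
      field_simp
    rw [e] at h
    refine h.congr fun t => ?_
    congr 3
    ext ω
    rw [div_mul_eq_mul_div, div_lt_iff₀ hv, mul_comm r, mul_comm (X ω)]

lemma tendsto_zero_of_tendsto_rpow_mul {f : τ → ℝ} {L : ℝ} (hα : 0 < α)
    (ha : Tendsto a l atTop) (hf : Tendsto (fun t => a t ^ α * f t) l (𝓝 L)) :
    Tendsto f l (𝓝 0) := by
  have h := ((tendsto_rpow_neg_atTop hα).comp ha).mul hf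
  rw [zero_mul] at h
  refine h.congr' ?_
  filter_upwards [ha.eventually_gt_atTop 0] with t ht
  have e : a t ^ (-α) * a t ^ α = 1 := by rw [← Real.rpow_add ht]; simp
  simp only [Function.comp]
  linear_combination f t * e

/-- Two-sided tails. -/
lemma tendsto_rpow_mul_abs_tail [IsFiniteMeasure μ] {X : Ω → ℝ} (hXm : Measurable X) {c : ℝ}
    (hR : Tendsto (fun x : ℝ => x ^ α * μ.real {ω | x < X ω}) atTop (𝓝 c))
    (hL : Tendsto (fun x : ℝ => x ^ α * μ.real {ω | X ω < -x}) atTop (𝓝 0)) :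
    Tendsto (fun x : ℝ => x ^ α * μ.real {ω | x < |X ω|}) atTop (𝓝 c) := by
  have h := hR.add hL
  rw [add_zero] at h
  refine h.congr' ?_
  filter_upwards [eventually_gt_atTop 0] with x hx
  have e : {ω | x < |X ω|} = {ω | x < X ω} ∪ {ω | X ω < -x} := by
    ext ω
    simp only [mem_ofPred_eq, mem_union, lt_abs]
    constructor <;> rintro (h | h)
    · exact Or.inl h
    · exact Or.inr (by linarith)
    · exact Or.inl h
    · exact Or.inr (by linarith)
  rw [e, measureReal_union _ (measurableSet_lt hXm measurable_const), mul_add]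
  rw [Set.disjoint_left]
  intro ω h1 h2
  simp only [mem_ofPred_eq] at h1 h2
  linarith

variable [Fintype ι] {S : ι → Ω → ℝ} {c : ι → ℝ}

/-- At least two of the variables exceed the threshold `t` in absolute value. -/
def twoJumps (S : ι → Ω → ℝ) (t : ℝ) : Set Ω :=
  {ω | ∃ j k, j ≠ k ∧ t < |S j ω| ∧ t < |S k ω|}

lemma measurableSet_twoJumps (hSm : ∀ k, Measurable (S k)) (t : ℝ) :
    MeasurableSet (twoJumps S t) := by
  have : twoJumps S t = ⋃ j, ⋃ k, ⋃ (_ : j ≠ k), {ω | t < |S j ω|} ∩ {ω | t < |S k ω|} := by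
    ext ω
    simp only [twoJumps, mem_ofPred_eq, mem_iUnion, mem_inter_iff, exists_prop]
  rw [this]
  exact MeasurableSet.iUnion fun j => MeasurableSet.iUnion fun k => MeasurableSet.iUnion fun _ =>
    (measurableSet_lt measurable_const (hSm j).abs).inter
      (measurableSet_lt measurable_const (hSm k).abs)

/-- By independence each pair costs a product of two tails: one absorbs the normalization, the other
still tends to `0`. -/
lemma tendsto_rpow_mul_twoJumps [IsFiniteMeasure μ] (hα : 0 < α)
    (hindep : Pairwise fun j k => IndepFun (S j) (S k) μ)
    (hA : ∀ k, Tendsto (fun x : ℝ => x ^ α * μ.real {ω | x < |S k ω|}) atTop (𝓝 (c k)))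
    (ha : Tendsto a l atTop) {η : ℝ} (hη : 0 < η) :
    Tendsto (fun t => a t ^ α * μ.real (twoJumps S (η * a t))) l (𝓝 0) := by
  classical
  have h1 := fun k => tendsto_rpow_mul_comp_const_mul (hA k) ha hη
  have h2 : ∀ k, Tendsto (fun t => μ.real {ω | η * a t < |S k ω|}) l (𝓝 0) := fun k =>
    tendsto_zero_of_tendsto_rpow_mul hα ha (h1 k)
  have h3 : Tendsto (fun t => ∑ j, ∑ k, a t ^ α * μ.real {ω | η * a t < |S j ω|} *
      μ.real {ω | η * a t < |S k ω|}) l (𝓝 0) := by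
    have := tendsto_finsetSum (Finset.univ : Finset ι) fun j _ =>
      tendsto_finsetSum (Finset.univ : Finset ι) fun k _ => (h1 j).mul (h2 k)
    simpa using this
  refine squeeze_zero' ?_ ?_ h3
  · filter_upwards [ha.eventually_gt_atTop 0] with t ht
    positivity
  · filter_upwards [ha.eventually_gt_atTop 0] with t ht
    simp only [mul_assoc, ← Finset.mul_sum]
    refine mul_le_mul_of_nonneg_left ?_ (by positivity)
    have hsub : twoJumps S (η * a t) ⊆ ⋃ j, ⋃ k, if j ≠ k then
        {ω | η * a t < |S j ω|} ∩ {ω | η * a t < |S k ω|} else ∅ := by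
      rintro ω ⟨j, k, hjk, hj, hk⟩
      simp only [mem_iUnion]
      refine ⟨j, k, ?_⟩
      rw [if_pos hjk]
      exact ⟨hj, hk⟩
    refine (measureReal_mono hsub).trans ?_
    refine (measureReal_iUnion_fintype_le _).trans (Finset.sum_le_sum fun j _ => ?_)
    rw [Finset.mul_sum]
    refine (measureReal_iUnion_fintype_le _).trans (Finset.sum_le_sum fun k _ => ?_)
    split_ifs with hjk
    · have hm : MeasurableSet {y : ℝ | η * a t < |y|} :=
        measurableSet_lt measurable_const measurable_id.abs
      have := (hindep hjk).measure_inter_preimage_eq_mul _ _ hm hm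
      have e := congrArg ENNReal.toReal this
      rw [ENNReal.toReal_mul] at e
      exact e.le
    · simp only [measureReal_empty]
      positivity

/-- **Single big jump principle**: if `E t` is, up to small relative errors `η`, up to events of
probability `o(a(t) ^ (-α))` and up to two simultaneous jumps, the event that some `v k * S k`
exceeds `a t`, then `P(E t)` is asymptotic to `∑ k, c k * v k ^ α * a(t) ^ (-α)`. -/
lemma tendsto_rpow_mul_of_big_jump [IsFiniteMeasure μ] (hα : 0 < α)
    (hSm : ∀ k, Measurable (S k)) (hindep : Pairwise fun j k => IndepFun (S j) (S k) μ)
    (hR : ∀ k, Tendsto (fun x : ℝ => x ^ α * μ.real {ω | x < S k ω}) atTop (𝓝 (c k)))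
    (hL : ∀ k, Tendsto (fun x : ℝ => x ^ α * μ.real {ω | S k ω < -x}) atTop (𝓝 0))
    (ha : Tendsto a l atTop) {v : ι → ℝ} (hv : ∀ k, 0 ≤ v k) {W : ℝ} (hW : 0 ≤ W) {E : τ → Set Ω}
    (hup : ∀ᶠ η in 𝓝[>] (0 : ℝ), ∃ N : τ → Set Ω,
      Tendsto (fun t => a t ^ α * μ.real (N t)) l (𝓝 0) ∧
      ∀ᶠ t in l, ∀ ω ∈ E t, ω ∉ twoJumps S (η * a t) →
        (∃ k, a t * (1 - η * W) < v k * S k ω) ∨ ω ∈ N t)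
    (hlow : ∀ᶠ η in 𝓝[>] (0 : ℝ), ∀ᶠ t in l, ∀ ω k, a t * (1 + η * W) < v k * S k ω →
      (∀ j, j ≠ k → |S j ω| ≤ η * a t) → ω ∈ E t) :
    Tendsto (fun t => a t ^ α * μ.real (E t)) l (𝓝 (∑ k, c k * v k ^ α)) := by
  have hA := fun k => tendsto_rpow_mul_abs_tail (hSm k) (hR k) (hL k)
  have hcont : ∀ σ : ℝ, Tendsto (fun η : ℝ => ∑ k, c k * v k ^ α * (1 + σ * η * W) ^ (-α))
      (𝓝[>] 0) (𝓝 (∑ k, c k * v k ^ α)) := by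
    intro σ
    refine tendsto_finsetSum _ fun k _ => ?_
    have h1 : Tendsto (fun η : ℝ => 1 + σ * η * W) (𝓝[>] 0) (𝓝 1) := by
      have : Continuous fun η : ℝ => 1 + σ * η * W := by fun_prop
      have := this.tendsto 0
      simp only [mul_zero, zero_mul, add_zero] at this
      exact this.mono_left nhdsWithin_le_nhds
    have h2 := (h1.rpow_const (p := -α) (Or.inl one_ne_zero)).const_mul (c k * v k ^ α)
    simpa using h2
  refine tendsto_order.2 ⟨fun b hb => ?_, fun b hb => ?_⟩
  -- Lower bound: outside the two-jump event the sets `G k` are disjoint subsets of `E t`, so their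
  -- probabilities add. The two-jump event is lost once for each `k`, hence the factor `Fintype.card
  -- ι`.
  · obtain ⟨η, hη1, hη2, hη3, hη4⟩ := (((hcont 1).eventually (lt_mem_nhds hb)).and
      (hlow.and ((eventually_all.2 fun k => eventually_mul_lt_one (v k)).and self_mem_nhdsWithin))).exists
    have hη0 : 0 < η := hη4
    have hηW : 0 ≤ η * W := by positivity
    have hG := tendsto_finsetSum (Finset.univ : Finset ι) fun k _ =>
      tendsto_rpow_mul_tail_const_mul (a := a) (r := 1 + η * W) hα (hR k) ha (hv k) (by positivity)
    have hT := (tendsto_rpow_mul_twoJumps hα hindep hA ha hη0).const_mul (Fintype.card ι : ℝ)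
    have hdiff := hG.sub hT
    simp only [mul_zero, sub_zero] at hdiff
    simp only [one_mul] at hη1
    filter_upwards [hdiff.eventually (lt_mem_nhds hη1), hη2, ha.eventually_gt_atTop 0]
      with t ht hE hat
    refine ht.trans_le ?_
    rw [mul_left_comm, ← Finset.mul_sum, ← mul_sub]
    refine mul_le_mul_of_nonneg_left ?_ (by positivity)
    set T := twoJumps S (η * a t) with hTdef
    have hTm : MeasurableSet T := measurableSet_twoJumps hSm _
    set G : ι → Set Ω := fun k => {ω | a t * (1 + η * W) < v k * S k ω} with hGdef
    have hGm : ∀ k, MeasurableSet (G k) := fun k =>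
      measurableSet_lt measurable_const ((hSm k).const_mul _)
    -- Uses `η * v k < 1`: exceeding `a t` after multiplication by `v k` forces a jump above `η * a
    -- t`.
    have hjump : ∀ k, ∀ ω ∈ G k, η * a t < |S k ω| := by
      intro k ω hω
      have h1 : a t * (1 + η * W) < v k * S k ω := hω
      by_contra! hcon
      have h2 : v k * S k ω ≤ v k * (η * a t) :=
        mul_le_mul_of_nonneg_left ((le_abs_self _).trans hcon) (hv k)
      nlinarith [hη3 k, mul_pos hat (sub_pos.2 (hη3 k)), mul_nonneg hat.le hηW]
    have hGT : ∀ k, μ.real (G k) ≤ μ.real (G k \ T) + μ.real T := by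
      intro k
      refine (measureReal_mono (s₂ := (G k \ T) ∪ T) ?_).trans (measureReal_union_le _ _)
      intro ω hω
      by_cases h : ω ∈ T
      · exact Or.inr h
      · exact Or.inl ⟨hω, h⟩
    have hdis : Pairwise (Function.onFun Disjoint fun k => G k \ T) := by
      intro j k hjk
      refine Set.disjoint_left.2 fun ω h1 h2 => h1.2 ?_
      exact ⟨j, k, hjk, hjump j ω h1.1, hjump k ω h2.1⟩
    have hsubE : (⋃ k, G k \ T) ⊆ E t := by
      intro ω hω
      obtain ⟨k, hk⟩ := mem_iUnion.1 hω
      refine hE ω k hk.1 fun j hj => ?_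
      by_contra! hcon
      exact hk.2 ⟨j, k, hj, hcon, hjump k ω hk.1⟩
    have hun : μ.real (⋃ k, G k \ T) = ∑ k, μ.real (G k \ T) :=
      measureReal_iUnion_fintype hdis fun k => (hGm k).diff hTm
    have h1 : ∑ k, μ.real (G k) ≤ ∑ k, (μ.real (G k \ T) + μ.real T) :=
      Finset.sum_le_sum fun k _ => hGT k
    rw [Finset.sum_add_distrib, ← hun, Finset.sum_const, nsmul_eq_mul, Finset.card_univ] at h1
    have h2 := measureReal_mono (μ := μ) hsubE
    linarith
  -- Upper bound: a plain union bound, then `η` close enough to `0`.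
  · obtain ⟨η, hη1, ⟨N, hN, hE⟩, hη3, hη4⟩ := (((hcont (-1)).eventually (gt_mem_nhds hb)).and
      (hup.and ((eventually_mul_lt_one W).and self_mem_nhdsWithin))).exists
    have hη0 : 0 < η := hη4
    have hG := tendsto_finsetSum (Finset.univ : Finset ι) fun k _ =>
      tendsto_rpow_mul_tail_const_mul (a := a) (r := 1 - η * W) hα (hR k) ha (hv k) (by linarith)
    have hT := tendsto_rpow_mul_twoJumps hα hindep hA ha hη0
    have hsum := (hT.add hG).add hN
    simp only [add_zero, zero_add] at hsum
    simp only [neg_mul, one_mul, ← sub_eq_add_neg] at hη1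
    filter_upwards [hsum.eventually (gt_mem_nhds hη1), hE, ha.eventually_gt_atTop 0]
      with t ht hE hat
    refine lt_of_le_of_lt ?_ ht
    rw [← Finset.mul_sum, ← mul_add, ← mul_add]
    refine mul_le_mul_of_nonneg_left ?_ (by positivity)
    have hsub : E t ⊆ (twoJumps S (η * a t) ∪ ⋃ k, {ω | a t * (1 - η * W) < v k * S k ω}) ∪ N t := by
      intro ω hω
      by_cases h : ω ∈ twoJumps S (η * a t)
      · exact Or.inl (Or.inl h)
      · rcases hE ω hω h with ⟨k, hk⟩ | h'
        · exact Or.inl (Or.inr (mem_iUnion.2 ⟨k, hk⟩))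
        · exact Or.inr h'
    refine (measureReal_mono hsub).trans ((measureReal_union_le _ _).trans ?_)
    refine add_le_add_left ((measureReal_union_le _ _).trans ?_) _
    exact add_le_add_right (measureReal_iUnion_fintype_le _) _

end BigJump

/-! ### Tails of mixtures -/

section Mixture

variable {Ω 𝒮 : Type*} {K : ℕ} {w : Fin K → 𝒮 → ℝ} {S : Fin K → Ω → ℝ}

lemma mem_active {k : Fin K} {s : 𝒮} : k ∈ active w s ↔ w k s ≠ 0 := by
  simp [active]

lemma abs_mixture_sub_le (hw : ∀ k s, 0 ≤ w k s) (s : 𝒮) {ω : Ω} {t : ℝ} (k : Fin K) (ht : 0 ≤ t)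
    (h : ∀ j, j ≠ k → |S j ω| ≤ t) : |mixture w S s ω - w k s * S k ω| ≤ t * ∑ j, w j s := by
  have e : mixture w S s ω - w k s * S k ω = ∑ j ∈ Finset.univ.erase k, w j s * S j ω := by
    rw [mixture, ← Finset.add_sum_erase _ _ (Finset.mem_univ k)]
    ring
  rw [e, Finset.mul_sum]
  calc |∑ j ∈ Finset.univ.erase k, w j s * S j ω|
      ≤ ∑ j ∈ Finset.univ.erase k, |w j s * S j ω| := Finset.abs_sum_le_sum_abs _ _
    _ ≤ ∑ j ∈ Finset.univ.erase k, t * w j s := by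
        refine Finset.sum_le_sum fun j hj => ?_
        rw [abs_mul, abs_of_nonneg (hw j s), mul_comm]
        exact mul_le_mul_of_nonneg_right (h j (Finset.ne_of_mem_erase hj)) (hw j s)
    _ ≤ ∑ j, t * w j s := Finset.sum_le_sum_of_subset_of_nonneg (Finset.erase_subset _ _)
        fun j _ _ => mul_nonneg ht (hw j s)

lemma abs_mixture_le (hw : ∀ k s, 0 ≤ w k s) (s : 𝒮) {ω : Ω} {t : ℝ}
    (h : ∀ j, |S j ω| ≤ t) : |mixture w S s ω| ≤ t * ∑ j, w j s := by
  rw [Finset.mul_sum]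
  refine (Finset.abs_sum_le_sum_abs _ _).trans (Finset.sum_le_sum fun j _ => ?_)
  rw [abs_mul, abs_of_nonneg (hw j s), mul_comm]
  exact mul_le_mul_of_nonneg_right (h j) (hw j s)

/-- Off the event of two jumps, a mixture above the level has exactly one jump. -/
lemma exists_jump_of_notMem_twoJumps (hw : ∀ k s, 0 ≤ w k s) (s : 𝒮) {ω : Ω} {a η W : ℝ}
    (ha : 0 < a) (hW : ∑ j, w j s ≤ W) (hη : 0 < η) (hηW : η * W < 1)
    (hω : a < mixture w S s ω) (h2 : ω ∉ twoJumps S (η * a)) :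
    ∃ k, η * a < |S k ω| ∧ ∀ j, j ≠ k → |S j ω| ≤ η * a := by
  by_cases h : ∃ k, η * a < |S k ω|
  · obtain ⟨k, hk⟩ := h
    refine ⟨k, hk, fun j hj => ?_⟩
    by_contra! hcon
    exact h2 ⟨j, k, hj, hcon, hk⟩
  · push Not at h
    exfalso
    have h1 := (le_abs_self _).trans (abs_mixture_le (w := w) hw s h)
    have h3 : η * a * ∑ j, w j s ≤ η * a * W := mul_le_mul_of_nonneg_left hW (by positivity)
    nlinarith

variable [MeasurableSpace Ω] {μ : Measure Ω} {α : ℝ} {c : Fin K → ℝ}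

lemma measurable_mixture (hSm : ∀ k, Measurable (S k)) (s : 𝒮) : Measurable (mixture w S s) := by
  unfold mixture
  fun_prop

/-- Joint tails of two mixtures at the same level. -/
lemma tendsto_rpow_mul_joint_tail [IsFiniteMeasure μ] (hα : 0 < α)
    (hSm : ∀ k, Measurable (S k)) (hindep : Pairwise fun j k => IndepFun (S j) (S k) μ)
    (hR : ∀ k, Tendsto (fun x : ℝ => x ^ α * μ.real {ω | x < S k ω}) atTop (𝓝 (c k)))
    (hL : ∀ k, Tendsto (fun x : ℝ => x ^ α * μ.real {ω | S k ω < -x}) atTop (𝓝 0))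
    (hw : ∀ k s, 0 ≤ w k s) (s t : 𝒮) :
    Tendsto (fun x : ℝ => x ^ α * μ.real {ω | x < mixture w S s ω ∧ x < mixture w S t ω}) atTop
      (𝓝 (∑ k, c k * min (w k s) (w k t) ^ α)) := by
  have hs0 : 0 ≤ ∑ j, w j s := Finset.sum_nonneg fun j _ => hw j s
  have ht0 : 0 ≤ ∑ j, w j t := Finset.sum_nonneg fun j _ => hw j t
  set W := ∑ j, w j s + ∑ j, w j t with hW
  refine tendsto_rpow_mul_of_big_jump hα hSm hindep hR hL tendsto_id
    (fun k => le_min (hw k s) (hw k t)) (W := W) (by positivity) ?_ ?_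
  · filter_upwards [eventually_mul_lt_one W, self_mem_nhdsWithin] with η hη hη0
    have hη0' : 0 < η := hη0
    refine ⟨fun _ => ∅, by simp, ?_⟩
    filter_upwards [eventually_gt_atTop 0] with x hx ω hω h2
    simp only [id] at h2 ⊢
    obtain ⟨k, -, hk⟩ :=
      exists_jump_of_notMem_twoJumps hw s hx (W := W) (by linarith) hη0' hη hω.1 h2
    refine Or.inl ⟨k, ?_⟩
    have hηx : 0 ≤ η * x := by positivity
    have hdev : ∀ r, ∑ j, w j r ≤ W → x < mixture w S r ω → x * (1 - η * W) < w k r * S k ω := by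
      intro r hr hxr
      have h3 := (abs_le.1 (abs_mixture_sub_le hw r k hηx hk)).2
      have h4 : η * x * ∑ j, w j r ≤ η * x * W := mul_le_mul_of_nonneg_left hr hηx
      nlinarith
    rcases min_choice (w k s) (w k t) with h | h <;> rw [h]
    · exact hdev s (by linarith) hω.1
    · exact hdev t (by linarith) hω.2
  · filter_upwards [self_mem_nhdsWithin] with η hη0
    have hη0' : 0 < η := hη0
    filter_upwards [eventually_gt_atTop 0] with x hx ω k hk hj
    simp only [id] at hk hj
    have hηx : 0 ≤ η * x := by positivity
    have hW0 : 0 ≤ W := by positivity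
    have hS : 0 < S k ω := by
      by_contra! hcon
      have := mul_nonpos_of_nonneg_of_nonpos (le_min (hw k s) (hw k t)) hcon
      have : 0 < x * (1 + η * W) := by positivity
      linarith
    have hdev : ∀ r, ∑ j, w j r ≤ W → min (w k s) (w k t) ≤ w k r → x < mixture w S r ω := by
      intro r hr hmr
      have h3 := (abs_le.1 (abs_mixture_sub_le hw r k hηx hj)).1
      have h4 : η * x * ∑ j, w j r ≤ η * x * W := mul_le_mul_of_nonneg_left hr hηx
      have h5 := mul_le_mul_of_nonneg_right hmr hS.le
      nlinarith
    exact ⟨hdev s (by linarith) (min_le_left _ _), hdev t (by linarith) (min_le_right _ _)⟩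

lemma tendsto_rpow_mul_mixture_tail [IsFiniteMeasure μ] (hα : 0 < α)
    (hSm : ∀ k, Measurable (S k)) (hindep : Pairwise fun j k => IndepFun (S j) (S k) μ)
    (hR : ∀ k, Tendsto (fun x : ℝ => x ^ α * μ.real {ω | x < S k ω}) atTop (𝓝 (c k)))
    (hL : ∀ k, Tendsto (fun x : ℝ => x ^ α * μ.real {ω | S k ω < -x}) atTop (𝓝 0))
    (hw : ∀ k s, 0 ≤ w k s) (s : 𝒮) :
    Tendsto (fun x : ℝ => x ^ α * μ.real {ω | x < mixture w S s ω}) atTop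
      (𝓝 (∑ k, c k * w k s ^ α)) := by
  simpa using tendsto_rpow_mul_joint_tail hα hSm hindep hR hL hw s s

/-- The weights are nonnegative, so a very negative mixture needs a very negative `S k`. Dividing by
`W + 1` rather than `W` avoids a case distinction at `W = 0`. -/
lemma tendsto_rpow_mul_mixture_left_tail [IsFiniteMeasure μ]
    (hL : ∀ k, Tendsto (fun x : ℝ => x ^ α * μ.real {ω | S k ω < -x}) atTop (𝓝 0))
    (hw : ∀ k s, 0 ≤ w k s) (s : 𝒮) :
    Tendsto (fun x : ℝ => x ^ α * μ.real {ω | mixture w S s ω < -x}) atTop (𝓝 0) := by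
  set W := ∑ j, w j s with hW
  have hs0 : 0 ≤ W := Finset.sum_nonneg fun j _ => hw j s
  have hr : 0 < (W + 1)⁻¹ := by positivity
  have h1 := tendsto_finsetSum (Finset.univ : Finset (Fin K)) fun k _ =>
    tendsto_rpow_mul_comp_const_mul (hL k) tendsto_id hr
  simp only [zero_mul, Finset.sum_const_zero, id] at h1
  refine squeeze_zero' ?_ ?_ h1
  · filter_upwards [eventually_gt_atTop 0] with x hx
    positivity
  · filter_upwards [eventually_gt_atTop 0] with x hx
    rw [← Finset.mul_sum]
    refine mul_le_mul_of_nonneg_left ?_ (by positivity)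
    refine (measureReal_mono ?_).trans (measureReal_iUnion_fintype_le _)
    intro ω hω
    by_contra hcon
    simp only [mem_iUnion, mem_ofPred_eq, not_exists, not_lt] at hcon hω
    have h2 : ∑ j, w j s * -((W + 1)⁻¹ * x) ≤ mixture w S s ω :=
      Finset.sum_le_sum fun j _ => mul_le_mul_of_nonneg_left (hcon j) (hw j s)
    rw [← Finset.sum_mul, ← hW] at h2
    have h3 : W * (W + 1)⁻¹ ≤ 1 := by
      rw [mul_inv_le_iff₀ (by positivity)]; linarith
    nlinarith

lemma indepFun_mixture_of_disjoint (hSm : ∀ k, Measurable (S k)) (hindep : iIndepFun S μ)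
    {s t : 𝒮} (h : active w s ∩ active w t = ∅) :
    IndepFun (mixture w S s) (mixture w S t) μ := by
  have h1 := hindep.indepFun_finset (active w s) (active w t)
    (Finset.disjoint_iff_inter_eq_empty.2 h) hSm
  have h2 : ∀ r : 𝒮, mixture w S r = (fun p : (active w r → ℝ) =>
      ∑ k : active w r, w k r * p k) ∘
      fun ω (k : active w r) => S k ω := by
    intro r
    ext ω
    simp only [mixture, Function.comp]
    rw [Finset.sum_coe_sort (active w r) (fun k => w k r * S k ω)]
    symm
    refine Finset.sum_subset (Finset.subset_univ _) fun k _ hk => ?_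
    have : w k r = 0 := by simpa [mem_active] using hk
    rw [this, zero_mul]
  rw [h2 s, h2 t]
  exact h1.comp (by fun_prop) (by fun_prop)

/-- Adjoining a location `none` whose only active kernel is the `k`-th makes `S k` itself a mixture,
so the disjoint case applies. -/
lemma indepFun_apply_mixture (hSm : ∀ k, Measurable (S k)) (hindep : iIndepFun S μ)
    {t : 𝒮} {k : Fin K} (h : w k t = 0) : IndepFun (S k) (mixture w S t) μ := by
  have h1 := indepFun_mixture_of_disjoint (𝒮 := Option 𝒮)
    (w := fun j r => r.elim (if j = k then 1 else 0) fun s => w j s) hSm hindep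
    (s := none) (t := some t) ?_
  · have e1 : mixture (fun j (r : Option 𝒮) => r.elim (if j = k then 1 else 0) fun s => w j s) S
        none = S k := by
      ext ω
      simp [mixture]
    rw [e1] at h1
    exact h1
  · ext j
    simp only [Finset.mem_inter, mem_active, Option.elim, Finset.notMem_empty, iff_false]
    rintro ⟨h2, h3⟩
    have : j = k := by
      by_contra hne
      simp [hne] at h2
    subst this
    exact h3 h

/-! ### Powers of mixtures with different exponents -/

/-- The threshold that `r` has to exceed for `c * r ^ φ` to exceed `x`. -/
def powThreshold (c φ x : ℝ) : ℝ := (x / c) ^ φ⁻¹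

variable {c₁ c₂ φ φ₁ φ₂ x r : ℝ}

lemma powThreshold_rpow (hc : 0 < c₁) (hφ : 0 < φ) (hx : 0 < x) :
    c₁ * powThreshold c₁ φ x ^ φ = x := by
  rw [powThreshold, ← Real.rpow_mul (by positivity), inv_mul_cancel₀ hφ.ne', Real.rpow_one]
  field_simp

lemma powThreshold_pos (hc : 0 < c₁) (hx : 0 < x) : 0 < powThreshold c₁ φ x := by
  unfold powThreshold
  positivity

lemma lt_mul_rpow_of_powThreshold_lt (hc : 0 < c₁) (hφ : 0 < φ) (hx : 0 < x)
    (h : powThreshold c₁ φ x < r) : x < c₁ * r ^ φ := by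
  rw [← powThreshold_rpow hc hφ hx]
  exact mul_lt_mul_of_pos_left
    (Real.rpow_lt_rpow (powThreshold_pos hc hx).le h hφ) hc

/-- The power of a negative number is `|r| ^ φ * cos (π φ)`, at most `|r| ^ φ`. Negative values can
thus contribute only through the left tail, which is negligible. -/
lemma powThreshold_lt_abs_of_lt_mul_rpow (hc : 0 < c₁) (hφ : 0 < φ) (hx : 0 < x)
    (h : x < c₁ * r ^ φ) : powThreshold c₁ φ x < |r| := by
  by_contra! hcon
  have h1 : |r| ^ φ ≤ powThreshold c₁ φ x ^ φ := Real.rpow_le_rpow (abs_nonneg _) hcon hφ.le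
  have h2 : r ^ φ ≤ |r| ^ φ := (le_abs_self _).trans (Real.abs_rpow_le_abs_rpow r φ)
  have h3 := powThreshold_rpow hc hφ hx
  nlinarith [mul_le_mul_of_nonneg_left (h2.trans h1) hc.le]

lemma tendsto_powThreshold (hc : 0 < c₁) (hφ : 0 < φ) :
    Tendsto (powThreshold c₁ φ) atTop atTop :=
  (tendsto_rpow_atTop (inv_pos.2 hφ)).comp (tendsto_id.atTop_div_const hc)

/-- The threshold for the larger exponent is of smaller order. -/
lemma tendsto_powThreshold_div (hc₁ : 0 < c₁) (hc₂ : 0 < c₂) (hφ₁ : 0 < φ₁) (hφ : φ₁ < φ₂) :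
    Tendsto (fun x => powThreshold c₂ φ₂ x / powThreshold c₁ φ₁ x) atTop (𝓝 0) := by
  have hlt : φ₂⁻¹ < φ₁⁻¹ := inv_strictAnti₀ hφ₁ hφ
  have h := (tendsto_rpow_neg_atTop (sub_pos.2 hlt)).const_mul (c₁ ^ φ₁⁻¹ / c₂ ^ φ₂⁻¹)
  rw [mul_zero] at h
  refine h.congr' ?_
  filter_upwards [eventually_gt_atTop 0] with x hx
  rw [powThreshold, powThreshold, Real.div_rpow hx.le hc₁.le, Real.div_rpow hx.le hc₂.le, neg_sub,
    Real.rpow_sub hx]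
  field_simp

lemma isEquivalent_of_tendsto_rpow_mul {f : ℝ → ℝ} {L p : ℝ} (hL : L ≠ 0)
    (h : Tendsto (fun x : ℝ => x ^ p * f x) atTop (𝓝 L)) :
    f ~[atTop] fun x => L * x ^ (-p) := by
  have hne : ∀ᶠ x : ℝ in atTop, L * x ^ (-p) ≠ 0 := by
    filter_upwards [eventually_gt_atTop 0] with x hx
    exact mul_ne_zero hL (by positivity)
  rw [isEquivalent_iff_tendsto_one hne]
  have h' := h.div_const L
  rw [div_self hL] at h'
  refine h'.congr' ?_
  filter_upwards [eventually_gt_atTop 0] with x hx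
  simp only [Pi.div_apply]
  rw [Real.rpow_neg hx.le]
  field_simp

lemma isEquivalent_of_tendsto_powThreshold {f : ℝ → ℝ} {L : ℝ} (hL : L ≠ 0) (hc : 0 < c₁)
    (h : Tendsto (fun x : ℝ => powThreshold c₁ φ x ^ α * f x) atTop (𝓝 L)) :
    f ~[atTop] fun x => L * c₁ ^ (α / φ) * x ^ (-(α / φ)) := by
  refine isEquivalent_of_tendsto_rpow_mul (mul_ne_zero hL (by positivity)) ?_
  refine (h.mul_const (c₁ ^ (α / φ))).congr' ?_
  filter_upwards [eventually_gt_atTop 0] with x hx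
  have e : powThreshold c₁ φ x ^ α * c₁ ^ (α / φ) = x ^ (α / φ) := by
    rw [powThreshold, ← Real.rpow_mul (by positivity), ← div_eq_inv_mul,
      ← Real.mul_rpow (by positivity) hc.le]
    congr 1
    field_simp
  rw [← e]
  ring

/-- The tail of the maximum of powers is the tail of the power with the larger exponent. -/
lemma tendsto_powThreshold_max {X Y : Ω → ℝ} [IsFiniteMeasure μ] {L M : ℝ} (hα : 0 < α)
    (hX : Tendsto (fun x : ℝ => x ^ α * μ.real {ω | x < |X ω|}) atTop (𝓝 M))
    (hY : Tendsto (fun x : ℝ => x ^ α * μ.real {ω | x < Y ω}) atTop (𝓝 L))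
    (hY' : Tendsto (fun x : ℝ => x ^ α * μ.real {ω | Y ω < -x}) atTop (𝓝 0))
    (hc₁ : 0 < c₁) (hc₂ : 0 < c₂) (hφ₁ : 0 < φ₁) (hφ : φ₁ < φ₂) :
    Tendsto (fun x : ℝ => powThreshold c₂ φ₂ x ^ α *
      μ.real {ω | x < max (c₁ * X ω ^ φ₁) (c₂ * Y ω ^ φ₂)}) atTop (𝓝 L) := by
  have hφ₂ := hφ₁.trans hφ
  have ha := tendsto_powThreshold hc₂ hφ₂
  have hlow := hY.comp ha
  -- The variable with the smaller exponent faces a threshold of larger order, so its contribution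
  -- vanishes at this normalization.
  have hX' : Tendsto (fun x => powThreshold c₂ φ₂ x ^ α *
      μ.real {ω | powThreshold c₁ φ₁ x < |X ω|}) atTop (𝓝 0) := by
    have h1 := ((tendsto_powThreshold_div hc₁ hc₂ hφ₁ hφ).rpow_const (p := α) (Or.inr hα.le)).mul
      (hX.comp (tendsto_powThreshold hc₁ hφ₁))
    rw [Real.zero_rpow hα.ne', zero_mul] at h1
    refine h1.congr' ?_
    filter_upwards [eventually_gt_atTop 0] with x hx
    have p1 := powThreshold_pos (φ := φ₁) hc₁ hx
    have p2 := powThreshold_pos (φ := φ₂) hc₂ hx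
    simp only [Function.comp]
    rw [Real.div_rpow p2.le p1.le]
    field_simp
  have hup := (hlow.add (hY'.comp ha)).add hX'
  rw [add_zero, add_zero] at hup
  refine tendsto_of_tendsto_of_tendsto_of_le_of_le' hlow hup ?_ ?_
  · filter_upwards [eventually_gt_atTop 0] with x hx
    have p2 := powThreshold_pos (φ := φ₂) hc₂ hx
    refine mul_le_mul_of_nonneg_left (measureReal_mono fun ω hω => ?_) (by positivity)
    exact lt_max_of_lt_right (lt_mul_rpow_of_powThreshold_lt hc₂ hφ₂ hx hω)
  · filter_upwards [eventually_gt_atTop 0] with x hx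
    have p2 := powThreshold_pos (φ := φ₂) hc₂ hx
    simp only [Function.comp]
    rw [← mul_add, ← mul_add]
    refine mul_le_mul_of_nonneg_left ?_ (by positivity)
    refine (measureReal_mono (s₂ := ({ω | powThreshold c₂ φ₂ x < Y ω} ∪
      {ω | Y ω < -powThreshold c₂ φ₂ x}) ∪ {ω | powThreshold c₁ φ₁ x < |X ω|}) ?_).trans ?_
    · intro ω hω
      simp only [mem_ofPred_eq, lt_max_iff] at hω
      rcases hω with h | h
      · exact Or.inr (powThreshold_lt_abs_of_lt_mul_rpow hc₁ hφ₁ hx h)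
      · rcases lt_abs.1 (powThreshold_lt_abs_of_lt_mul_rpow hc₂ hφ₂ hx h) with h' | h'
        · exact Or.inl (Or.inl h')
        · exact Or.inl (Or.inr (by simp only [mem_ofPred_eq]; linarith))
    · refine (measureReal_union_le _ _).trans ?_
      exact add_le_add_left (measureReal_union_le _ _) _

/-- The tail of the minimum of powers is governed by the jumps that are shared by both mixtures. -/
lemma tendsto_powThreshold_min [IsFiniteMeasure μ] (hα : 0 < α)
    (hSm : ∀ k, Measurable (S k)) (hindep : iIndepFun S μ)
    (hR : ∀ k, Tendsto (fun x : ℝ => x ^ α * μ.real {ω | x < S k ω}) atTop (𝓝 (c k)))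
    (hL : ∀ k, Tendsto (fun x : ℝ => x ^ α * μ.real {ω | S k ω < -x}) atTop (𝓝 0))
    (hw : ∀ k s, 0 ≤ w k s) (s t : 𝒮)
    (hc₁ : 0 < c₁) (hc₂ : 0 < c₂) (hφ₁ : 0 < φ₁) (hφ : φ₁ < φ₂) :
    Tendsto (fun x : ℝ => powThreshold c₁ φ₁ x ^ α *
      μ.real {ω | x < min (c₁ * mixture w S s ω ^ φ₁) (c₂ * mixture w S t ω ^ φ₂)}) atTop
      (𝓝 (∑ k, c k * (if w k t = 0 then 0 else w k s) ^ α)) := by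
  have hφ₂ := hφ₁.trans hφ
  have ha := tendsto_powThreshold hc₁ hφ₁
  have hb := tendsto_powThreshold hc₂ hφ₂
  have hpair : Pairwise fun j k => IndepFun (S j) (S k) μ := fun j k hjk => hindep.indepFun hjk
  have hs0 : 0 ≤ ∑ j, w j s := Finset.sum_nonneg fun j _ => hw j s
  have ht0 : 0 ≤ ∑ j, w j t := Finset.sum_nonneg fun j _ => hw j t
  set W := ∑ j, w j s + ∑ j, w j t with hW
  have hW0 : 0 ≤ W := by positivity
  have hleft := tendsto_rpow_mul_mixture_left_tail hL hw s
  have habs := tendsto_rpow_mul_abs_tail (measurable_mixture hSm t)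
    (tendsto_rpow_mul_mixture_tail hα hSm hpair hR hL hw t)
    (tendsto_rpow_mul_mixture_left_tail hL hw t)
  have hsmall := (tendsto_zero_of_tendsto_rpow_mul hα tendsto_id habs).comp hb
  refine tendsto_rpow_mul_of_big_jump hα hSm hpair hR hL ha (W := W)
    (fun k => by split_ifs; exacts [le_rfl, hw k s]) hW0 ?_ ?_
  · filter_upwards [eventually_mul_lt_one W, self_mem_nhdsWithin] with η hη hη0
    have hη0' : 0 < η := hη0
    -- The exceptional event: a large negative mixture at `s`, or a jump of some `S k` inactive at
    -- `t` while the mixture at `t`, independent of `S k`, is large on its own. The latter has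
    -- probability `O(a ^ (-α)) * o(1)`.
    refine ⟨fun x => {ω | mixture w S s ω < -powThreshold c₁ φ₁ x} ∪
      ⋃ k : {k // w k t = 0}, {ω | η * powThreshold c₁ φ₁ x < |S k ω|} ∩
        {ω | powThreshold c₂ φ₂ x < |mixture w S t ω|}, ?_, ?_⟩
    · have h1 : ∀ k : {k // w k t = 0}, Tendsto (fun x => powThreshold c₁ φ₁ x ^ α *
          μ.real ({ω | η * powThreshold c₁ φ₁ x < |S k ω|} ∩
            {ω | powThreshold c₂ φ₂ x < |mixture w S t ω|})) atTop (𝓝 0) := by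
        intro k
        have h2 := (tendsto_rpow_mul_comp_const_mul
          (tendsto_rpow_mul_abs_tail (hSm k) (hR k) (hL k)) ha hη0').mul hsmall
        rw [mul_zero] at h2
        refine h2.congr fun x => ?_
        have hm : ∀ q : ℝ, MeasurableSet {y : ℝ | q < |y|} := fun q =>
          measurableSet_lt measurable_const measurable_id.abs
        have h3 := congrArg ENNReal.toReal
          ((indepFun_apply_mixture hSm hindep k.2).measure_inter_preimage_eq_mul _ _
            (hm (η * powThreshold c₁ φ₁ x)) (hm (powThreshold c₂ φ₂ x)))
        rw [ENNReal.toReal_mul] at h3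
        rw [mul_assoc]
        congr 1
        exact h3.symm
      have h4 := (hleft.comp ha).add (tendsto_finsetSum Finset.univ fun k _ => h1 k)
      simp only [Finset.sum_const_zero, add_zero] at h4
      refine squeeze_zero' ?_ ?_ h4
      · filter_upwards [eventually_gt_atTop 0] with x hx
        have := powThreshold_pos (φ := φ₁) hc₁ hx
        positivity
      · filter_upwards [eventually_gt_atTop 0] with x hx
        have := powThreshold_pos (φ := φ₁) hc₁ hx
        simp only [Function.comp]
        rw [← Finset.mul_sum, ← mul_add]
        refine mul_le_mul_of_nonneg_left ?_ (by positivity)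
        refine (measureReal_union_le _ _).trans ?_
        exact add_le_add_right (measureReal_iUnion_fintype_le _) _
    · filter_upwards [eventually_gt_atTop 0] with x hx ω hω h2
      have hax := powThreshold_pos (φ := φ₁) hc₁ hx
      obtain ⟨hω1, hω2⟩ := lt_min_iff.1 hω
      have hbt := powThreshold_lt_abs_of_lt_mul_rpow hc₂ hφ₂ hx hω2
      rcases lt_abs.1 (powThreshold_lt_abs_of_lt_mul_rpow hc₁ hφ₁ hx hω1) with h | h
      · obtain ⟨k, hk1, hk⟩ :=
          exists_jump_of_notMem_twoJumps hw s hax (W := W) (by linarith) hη0' hη h h2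
        by_cases hkt : w k t = 0
        · exact Or.inr (Or.inr (mem_iUnion.2 ⟨⟨k, hkt⟩, hk1, hbt⟩))
        · refine Or.inl ⟨k, ?_⟩
          rw [if_neg hkt]
          have hηx : 0 ≤ η * powThreshold c₁ φ₁ x := by positivity
          have h3 := (abs_le.1 (abs_mixture_sub_le hw s k hηx hk)).2
          have h4 : η * powThreshold c₁ φ₁ x * ∑ j, w j s ≤ η * powThreshold c₁ φ₁ x * W :=
            mul_le_mul_of_nonneg_left (by linarith) hηx
          nlinarith
      · refine Or.inr (Or.inl ?_)
        simp only [mem_ofPred_eq]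
        linarith
  -- A jump lifting the mixture at `s` over `a` contributes more than `(w k t / w k s) * a` at `t`.
  -- Half of this pays for the other summands, at most `η * W * a`; the other half exceeds the
  -- threshold `b`, since `b / a → 0`.
  · have hev : ∀ᶠ η in 𝓝[>] (0 : ℝ), ∀ k, w k t ≠ 0 → w k s ≠ 0 → η * W < w k t / w k s / 2 := by
      refine eventually_all.2 fun k => ?_
      by_cases h : w k t ≠ 0 ∧ w k s ≠ 0
      · have h1 : 0 < w k t := lt_of_le_of_ne (hw k t) (Ne.symm h.1)
        have h2 : 0 < w k s := lt_of_le_of_ne (hw k s) (Ne.symm h.2)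
        filter_upwards [eventually_mul_lt_one (W / (w k t / w k s / 2))] with η hη _ _
        rwa [← mul_div_assoc, div_lt_one (by positivity)] at hη
      · exact Eventually.of_forall fun η h1 h2 => absurd ⟨h1, h2⟩ h
    filter_upwards [hev, self_mem_nhdsWithin] with η hη hη0
    have hη0' : 0 < η := hη0
    have hratio : ∀ᶠ x in atTop, ∀ k, w k t ≠ 0 → w k s ≠ 0 →
        powThreshold c₂ φ₂ x / powThreshold c₁ φ₁ x < w k t / w k s / 2 := by
      refine eventually_all.2 fun k => ?_
      by_cases h : w k t ≠ 0 ∧ w k s ≠ 0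
      · have h1 : 0 < w k t := lt_of_le_of_ne (hw k t) (Ne.symm h.1)
        have h2 : 0 < w k s := lt_of_le_of_ne (hw k s) (Ne.symm h.2)
        filter_upwards [(tendsto_powThreshold_div hc₁ hc₂ hφ₁ hφ).eventually
          (gt_mem_nhds (by positivity : 0 < w k t / w k s / 2))] with x hx _ _ using hx
      · exact Eventually.of_forall fun η h1 h2 => absurd ⟨h1, h2⟩ h
    filter_upwards [hratio, eventually_gt_atTop 0] with x hxr hx ω k hk hj
    have hax := powThreshold_pos (φ := φ₁) hc₁ hx
    set a := powThreshold c₁ φ₁ x with hadef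
    set b := powThreshold c₂ φ₂ x with hbdef
    have hηa : 0 ≤ η * a := by positivity
    have hηW : 0 ≤ η * W := by positivity
    have hpos : 0 < a * (1 + η * W) := by positivity
    by_cases hkt : w k t = 0
    · rw [if_pos hkt, zero_mul] at hk
      linarith
    rw [if_neg hkt] at hk
    have hks : w k s ≠ 0 := by
      intro h
      rw [h, zero_mul] at hk
      linarith
    have h1 : 0 < w k t := lt_of_le_of_ne (hw k t) (Ne.symm hkt)
    have h2 : 0 < w k s := lt_of_le_of_ne (hw k s) (Ne.symm hks)
    have d1 := (abs_le.1 (abs_mixture_sub_le hw s k hηa hj)).1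
    have d2 := (abs_le.1 (abs_mixture_sub_le hw t k hηa hj)).1
    have e1 : η * a * ∑ j, w j s ≤ η * a * W := mul_le_mul_of_nonneg_left (by linarith) hηa
    have e2 : η * a * ∑ j, w j t ≤ η * a * W := mul_le_mul_of_nonneg_left (by linarith) hηa
    have hRs : a < mixture w S s ω := by nlinarith
    have hSa : a / w k s < S k ω := by
      rw [div_lt_iff₀ h2]
      nlinarith [mul_nonneg hax.le hηW]
    have hb1 : b < w k t / w k s / 2 * a := by
      have := hxr k hkt hks
      rwa [div_lt_iff₀ hax] at this
    have hb2 : η * W * a ≤ w k t / w k s / 2 * a :=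
      mul_le_mul_of_nonneg_right (hη k hkt hks).le hax.le
    have hb3 : w k t / w k s * a < w k t * S k ω := by
      have := mul_lt_mul_of_pos_left hSa h1
      calc w k t / w k s * a = w k t * (a / w k s) := by ring
        _ < _ := this
    have hRt : b < mixture w S t ω := by nlinarith
    exact lt_min (lt_mul_rpow_of_powThreshold_lt hc₁ hφ₁ hx hRs)
      (lt_mul_rpow_of_powThreshold_lt hc₂ hφ₂ hx hRt)

end Mixture

/-! ### Stable tails of random variables, and the constants -/

section Tails

variable {Ω : Type*} [MeasurableSpace Ω] {μ : Measure Ω} [IsFiniteMeasure μ] {X : Ω → ℝ}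
  {α γ δ : ℝ}

lemma IsStable.tendsto_right_tail (hα0 : 0 < α) (hα2 : α < 2) (hγ : 0 < γ) (hXm : Measurable X)
    (hX : IsStable μ X α 1 γ δ) :
    Tendsto (fun x : ℝ => x ^ α * μ.real {ω | x < X ω}) atTop (𝓝 (2 * tailConst α * γ ^ α)) := by
  refine (tendsto_rpow_mul_stable_Ioi hα0 hα2 hγ hX).congr fun x => ?_
  rw [measureReal_def, Measure.map_apply hXm measurableSet_Ioi]
  rfl

lemma IsStable.tendsto_left_tail (hα0 : 0 < α) (hα2 : α < 2) (hγ : 0 < γ) (hXm : Measurable X)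
    (hX : IsStable μ X α 1 γ δ) :
    Tendsto (fun x : ℝ => x ^ α * μ.real {ω | X ω < -x}) atTop (𝓝 0) := by
  refine (tendsto_rpow_mul_stable_Iio hα0 hα2 hγ hX).congr fun x => ?_
  rw [measureReal_def, Measure.map_apply hXm measurableSet_Iio]
  rfl

end Tails

section Constants

variable {𝒮 : Type*} {K : ℕ} {α : ℝ} {w : Fin K → 𝒮 → ℝ} {γ : Fin K → ℝ}

lemma sum_univ_eq_sum_active (hα : 0 < α) (s : 𝒮) :
    ∑ k, (w k s * γ k) ^ α = ∑ k ∈ active w s, (w k s * γ k) ^ α := by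
  symm
  refine Finset.sum_subset (Finset.subset_univ _) fun k _ hk => ?_
  have : w k s = 0 := by simpa [mem_active] using hk
  rw [this, zero_mul, Real.zero_rpow hα.ne']

lemma sum_rpow_pos (hγ : ∀ k, 0 < γ k) (hw : ∀ k s, 0 ≤ w k s) {s : 𝒮} {A : Finset (Fin K)}
    (hA : A ⊆ active w s) (hne : A.Nonempty) : 0 < ∑ k ∈ A, (w k s * γ k) ^ α := by
  refine Finset.sum_pos (fun k hk => ?_) hne
  have h1 : 0 < w k s := lt_of_le_of_ne (hw k s) (Ne.symm (mem_active.1 (hA hk)))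
  have h2 := hγ k
  positivity

lemma gammaBar_rpow (hα : 0 < α) (hγ : ∀ k, 0 < γ k) (hw : ∀ k s, 0 ≤ w k s) (s : 𝒮) :
    gammaBar α w γ s ^ α = ∑ k, (w k s * γ k) ^ α := by
  have h : 0 ≤ ∑ k, (w k s * γ k) ^ α := Finset.sum_nonneg fun k _ =>
    Real.rpow_nonneg (mul_nonneg (hw k s) (hγ k).le) _
  rw [gammaBar, ← Real.rpow_mul h, one_div, inv_mul_cancel₀ hα.ne', Real.rpow_one]

lemma sharedConst_pos (hγ : ∀ k, 0 < γ k) (hw : ∀ k s, 0 ≤ w k s) {s t : 𝒮}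
    (h : (active w s ∩ active w t).Nonempty) : 0 < sharedConst α w γ s t := by
  obtain ⟨k, hk⟩ := h
  rw [Finset.mem_inter, mem_active, mem_active] at hk
  have h1 : 0 < min (w k s) (w k t) :=
    lt_min (lt_of_le_of_ne (hw k s) (Ne.symm hk.1)) (lt_of_le_of_ne (hw k t) (Ne.symm hk.2))
  have h2 := hγ k
  refine Finset.sum_pos' (fun j _ => ?_) ⟨k, Finset.mem_univ k, by positivity⟩
  have h3 := hγ j
  have h4 : 0 ≤ min (w j s) (w j t) := le_min (hw j s) (hw j t)
  positivity

/-- Accounts for the slack between the true constants, with factor `2`, and the stated upper bounds,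
with factor `2 ^ (α + 1)`. -/
lemma mul_le_two_rpow_mul {C A B D : ℝ} (hα : 0 < α) (hC : 0 ≤ C) (hA : A ≤ B) (hA0 : 0 ≤ A)
    (hD : 0 ≤ D) : 2 * C * A * D ≤ 2 ^ (α + 1) * C * B * D := by
  have h : (2 : ℝ) ≤ 2 ^ (α + 1) := by
    conv_lhs => rw [← Real.rpow_one 2]
    exact Real.rpow_le_rpow_of_exponent_le one_le_two (by linarith)
  gcongr

end Constants

end StableMixture
end

/-! ### Assembly of the two parts of the theorem -/

theorem proposition2 {Ω : Type*} [MeasurableSpace Ω] (μ : Measure Ω) [IsProbabilityMeasure μ]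
    {𝒮 : Type*} {K : ℕ} (α δ : ℝ) (hα0 : 0 < α) (hα2 : α < 2)
    (γ : Fin K → ℝ) (hγ : ∀ k, 0 < γ k)
    (w : Fin K → 𝒮 → ℝ) (hw : ∀ k s, 0 ≤ w k s)
    (hcover : ∀ s, (StableMixture.active w s).Nonempty)
    (S : Fin K → Ω → ℝ) (hSmeas : ∀ k, Measurable (S k)) (hSindep : iIndepFun S μ)
    (hS : ∀ k, StableMixture.IsStable μ (S k) α 1 (γ k) δ)
    (sᵢ sⱼ : 𝒮) :
    (StableMixture.active w sᵢ ∩ StableMixture.active w sⱼ = ∅ →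
      IndepFun (StableMixture.mixture w S sᵢ) (StableMixture.mixture w S sⱼ) μ ∧
      (fun x : ℝ => μ.real {ω | x < StableMixture.mixture w S sᵢ ω ∧
          x < StableMixture.mixture w S sⱼ ω})
        ~[atTop] fun x : ℝ => 4 * StableMixture.tailConst α ^ 2 *
          StableMixture.gammaBar α w γ sᵢ ^ α * StableMixture.gammaBar α w γ sⱼ ^ α *
          x ^ (-(2 * α))) ∧
    ((StableMixture.active w sᵢ ∩ StableMixture.active w sⱼ).Nonempty →
      (fun x : ℝ => μ.real {ω | x < StableMixture.mixture w S sᵢ ω ∧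
          x < StableMixture.mixture w S sⱼ ω})
        ~[atTop] fun x : ℝ => 2 * StableMixture.tailConst α *
          StableMixture.sharedConst α w γ sᵢ sⱼ * x ^ (-α)) ∧
    ((StableMixture.active w sᵢ ∩ StableMixture.active w sⱼ).Nonempty →
      ∀ φᵢ φⱼ cᵢ cⱼ : ℝ, 0 < φᵢ → φᵢ < φⱼ → 0 < cᵢ → 0 < cⱼ →
      (∃ dmin : ℝ,
        2 * StableMixture.tailConst α *
            (∑ k ∈ StableMixture.active w sᵢ ∩ StableMixture.active w sⱼ, (w k sᵢ * γ k) ^ α) *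
            cᵢ ^ (α / φᵢ) ≤ dmin ∧
        dmin ≤ 2 ^ (α + 1) * StableMixture.tailConst α *
            (∑ k ∈ StableMixture.active w sᵢ, (w k sᵢ * γ k) ^ α) * cᵢ ^ (α / φᵢ) ∧
        (fun x : ℝ => μ.real {ω | x < min (cᵢ * StableMixture.mixture w S sᵢ ω ^ φᵢ)
            (cⱼ * StableMixture.mixture w S sⱼ ω ^ φⱼ)})
          ~[atTop] fun x : ℝ => dmin * x ^ (-(α / φᵢ))) ∧
      (∃ dmax : ℝ,
        2 * StableMixture.tailConst α *
            (∑ k ∈ StableMixture.active w sᵢ ∩ StableMixture.active w sⱼ, (w k sⱼ * γ k) ^ α) *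
            cⱼ ^ (α / φⱼ) ≤ dmax ∧
        dmax ≤ 2 ^ (α + 1) * StableMixture.tailConst α *
            (∑ k ∈ StableMixture.active w sⱼ, (w k sⱼ * γ k) ^ α) * cⱼ ^ (α / φⱼ) ∧
        (fun x : ℝ => μ.real {ω | x < max (cᵢ * StableMixture.mixture w S sᵢ ω ^ φᵢ)
            (cⱼ * StableMixture.mixture w S sⱼ ω ^ φⱼ)})
          ~[atTop] fun x : ℝ => dmax * x ^ (-(α / φⱼ)))) := by
  have hC := StableMixture.tailConst_pos hα0 hα2
  have hR := fun k => (hS k).tendsto_right_tail hα0 hα2 (hγ k) (hSmeas k)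
  have hL := fun k => (hS k).tendsto_left_tail hα0 hα2 (hγ k) (hSmeas k)
  have hpair : Pairwise fun j k => IndepFun (S j) (S k) μ := fun j k hjk => hSindep.indepFun hjk
  have hmix := StableMixture.tendsto_rpow_mul_mixture_tail hα0 hSmeas hpair hR hL hw
  have hmixL := StableMixture.tendsto_rpow_mul_mixture_left_tail hL hw
  have hconst : ∀ s, ∑ k, 2 * StableMixture.tailConst α * γ k ^ α * w k s ^ α
      = 2 * StableMixture.tailConst α * ∑ k, (w k s * γ k) ^ α := by
    intro s
    rw [Finset.mul_sum]
    refine Finset.sum_congr rfl fun k _ => ?_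
    rw [Real.mul_rpow (hw k s) (hγ k).le]
    ring
  refine ⟨fun hdis => ?_, fun hne => ?_, fun hne φᵢ φⱼ cᵢ cⱼ hφᵢ hφ hcᵢ hcⱼ => ⟨?_, ?_⟩⟩
  · have hind := StableMixture.indepFun_mixture_of_disjoint hSmeas hSindep hdis
    refine ⟨hind, ?_⟩
    have hpos : ∀ s, 0 < ∑ k, (w k s * γ k) ^ α := fun s => by
      rw [StableMixture.sum_univ_eq_sum_active hα0]
      exact StableMixture.sum_rpow_pos hγ hw subset_rfl (hcover s)
    have h := (hmix sᵢ).mul (hmix sⱼ)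
    rw [hconst, hconst] at h
    rw [StableMixture.gammaBar_rpow hα0 hγ hw, StableMixture.gammaBar_rpow hα0 hγ hw]
    refine StableMixture.isEquivalent_of_tendsto_rpow_mul
      (by have := hpos sᵢ; have := hpos sⱼ; positivity) ?_
    have e : 2 * StableMixture.tailConst α * (∑ k, (w k sᵢ * γ k) ^ α) *
        (2 * StableMixture.tailConst α * ∑ k, (w k sⱼ * γ k) ^ α)
        = 4 * StableMixture.tailConst α ^ 2 * (∑ k, (w k sᵢ * γ k) ^ α) *
          ∑ k, (w k sⱼ * γ k) ^ α := by ring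
    rw [e] at h
    refine h.congr' ?_
    filter_upwards [eventually_gt_atTop 0] with x hx
    have h1 := congrArg ENNReal.toReal (hind.measure_inter_preimage_eq_mul _ _
      (measurableSet_Ioi (a := x)) (measurableSet_Ioi (a := x)))
    rw [ENNReal.toReal_mul] at h1
    have h2 : μ.real {ω | x < StableMixture.mixture w S sᵢ ω ∧ x < StableMixture.mixture w S sⱼ ω}
        = μ.real {ω | x < StableMixture.mixture w S sᵢ ω} *
          μ.real {ω | x < StableMixture.mixture w S sⱼ ω} := h1
    rw [h2, two_mul, Real.rpow_add hx]
    ring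
  · have h := StableMixture.tendsto_rpow_mul_joint_tail hα0 hSmeas hpair hR hL hw sᵢ sⱼ
    have e : ∑ k, 2 * StableMixture.tailConst α * γ k ^ α * min (w k sᵢ) (w k sⱼ) ^ α
        = 2 * StableMixture.tailConst α * StableMixture.sharedConst α w γ sᵢ sⱼ := by
      rw [StableMixture.sharedConst, Finset.mul_sum]
      exact Finset.sum_congr rfl fun k _ => by ring
    rw [e] at h
    have := StableMixture.sharedConst_pos (α := α) hγ hw hne
    exact StableMixture.isEquivalent_of_tendsto_rpow_mul (by positivity) h
  · have h := StableMixture.tendsto_powThreshold_min hα0 hSmeas hSindep hR hL hw sᵢ sⱼ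
      hcᵢ hcⱼ hφᵢ hφ
    have e : ∑ k, 2 * StableMixture.tailConst α * γ k ^ α *
        (if w k sⱼ = 0 then 0 else w k sᵢ) ^ α
        = 2 * StableMixture.tailConst α * ∑ k ∈ StableMixture.active w sᵢ ∩
          StableMixture.active w sⱼ, (w k sᵢ * γ k) ^ α := by
      rw [Finset.mul_sum]
      symm
      refine Finset.sum_subset_zero_on_sdiff (Finset.subset_univ _) (fun k hk => ?_)
        fun k hk => ?_
      · simp only [Finset.mem_sdiff, Finset.mem_univ, true_and, Finset.mem_inter,
          StableMixture.mem_active, not_and, not_not] at hk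
        have : (if w k sⱼ = 0 then 0 else w k sᵢ) = 0 := by
          split_ifs with h0
          · rfl
          · by_contra h1
            exact h0 (hk h1)
        rw [this, Real.zero_rpow hα0.ne', mul_zero]
      · have h0 : w k sⱼ ≠ 0 := StableMixture.mem_active.1 (Finset.mem_inter.1 hk).2
        rw [if_neg h0, Real.mul_rpow (hw k sᵢ) (hγ k).le]
        ring
    rw [e] at h
    have hpos := StableMixture.sum_rpow_pos (α := α) hγ hw Finset.inter_subset_left hne
    -- The limiting constant coincides with the lower bound, so `dmin` is forced to be that bound.
    refine ⟨_, le_rfl, ?_, StableMixture.isEquivalent_of_tendsto_powThreshold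
      (by positivity) hcᵢ h⟩
    have hsub : ∑ k ∈ StableMixture.active w sᵢ ∩ StableMixture.active w sⱼ, (w k sᵢ * γ k) ^ α
        ≤ ∑ k ∈ StableMixture.active w sᵢ, (w k sᵢ * γ k) ^ α :=
      Finset.sum_le_sum_of_subset_of_nonneg Finset.inter_subset_left fun k _ _ =>
        Real.rpow_nonneg (mul_nonneg (hw k sᵢ) (hγ k).le) _
    exact StableMixture.mul_le_two_rpow_mul hα0 hC.le hsub hpos.le (by positivity)
  · have habs := StableMixture.tendsto_rpow_mul_abs_tail
      (StableMixture.measurable_mixture hSmeas sᵢ) (hmix sᵢ) (hmixL sᵢ)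
    have h := StableMixture.tendsto_powThreshold_max hα0 habs (hmix sⱼ) (hmixL sⱼ) hcᵢ hcⱼ hφᵢ hφ
    rw [hconst, StableMixture.sum_univ_eq_sum_active hα0] at h
    have hpos := StableMixture.sum_rpow_pos (α := α) hγ hw subset_rfl (hcover sⱼ)
    have hsub : ∑ k ∈ StableMixture.active w sᵢ ∩ StableMixture.active w sⱼ, (w k sⱼ * γ k) ^ α
        ≤ ∑ k ∈ StableMixture.active w sⱼ, (w k sⱼ * γ k) ^ α :=
      Finset.sum_le_sum_of_subset_of_nonneg Finset.inter_subset_right fun k _ _ =>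
        Real.rpow_nonneg (mul_nonneg (hw k sⱼ) (hγ k).le) _
    -- Here the sum runs over all kernels active at `sⱼ`, since a jump need not be shared to lift
    -- the maximum.
    refine ⟨2 * StableMixture.tailConst α *
      (∑ k ∈ StableMixture.active w sⱼ, (w k sⱼ * γ k) ^ α) * cⱼ ^ (α / φⱼ), ?_, ?_,
      StableMixture.isEquivalent_of_tendsto_powThreshold (by positivity) hcⱼ h⟩
    · gcongr
    · exact StableMixture.mul_le_two_rpow_mul hα0 hC.le le_rfl hpos.le (by positivity)
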